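/- Let $\mathcal C$ be one of the Wigner–Dyson classes A, AI, AII or the Bogoliubov–de Gennes classes B/D, C, CI, DIII. Put $\delta=1$ for A, AI, B/D and $\delta=2$ for AII, C, CI, DIII, and let $\mathbb M_n^{\mathcal C}\subset\mathbb C^{\delta n\times\delta n}$ be the following space of matrices. - A: hermitian $n\times n$ matrices. AI: real symmetric $n\times n$ matrices. B/D: skew symmetric $n\times n$ matrices with entries in $i\mathbb R$. - AII: $\begin{pmatrix}X_1&X_2\\-\overline{X_2}&\overline{X_1}\end{pmatrix}$ with $X_1,X_2\in\mathbb C^{n\times n}$, $X_1$ hermitian, $X_2$ skew symmetric. - C: $\begin{pmatrix}X_1&X_2\\\overline{X_2}&-\overline{X_1}\end{pmatrix}$ with $X_1,X_2\in\mathbb C^{n\times n}$, $X_1$ hermitian, $X_2$ symmetric. - CI: $\begin{pmatrix}X_1&X_2\\X_2&-X_1\end{pmatrix}$ with $X_1,X_2\in\mathbb R^{n\times n}$ symmetric. - DIII: $\begin{pmatrix}X_1&X_2\\X_2&-X_1\end{pmatrix}$ with $X_1,X_2\in(i\mathbb R)^{n\times n}$ skew symmetric. Let $I_N=\{1,\dots,N\}$,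 and let $J_n^{\mathcal C}\subset I_{\delta n}^2$ be the set of index pairs $(p,q)$ such that some matrix in $\mathbb M_n^{\mathcal C}$ has a nonzero $(p,q)$ entry. For each $n$ let $\sim_n$ be an equivalence relation on $I_{\delta n}^2$ and let $$X_n=\Big(\tfrac1{\sqrt{\delta n}}\,a_n(p,q)\Big)_{p,q\in I_{\delta n}}$$ be a random matrix all of whose realizations belong to $\mathbb M_n^{\mathcal C}$, where the $a_n(p,q)$ are complex random variables. Assume that entries belonging to distinct equivalence classes are independent, in the sense that each $a_n(p,q)$ is independent of the family $\big(a_n(p',q')\big)_{(p',q')\not\sim_n(p,q)}$. Assume moreover, as $n\to\infty$, - (W1) $\max_p\#\{(q,p',q')\in I_{\delta n}^3:(p,q)\sim_n(p',q')\}=o(n^2)$; - (W2) there is a constant $B<\infty$ with $\max_{p,q,p'}\#\{q'\in I_{\delta n}:(p,q)\sim_n(p',q')\}\le B$ for all $n$; - (W3) $\#\{(p,q,p')\in I_{\delta n}^3:(p,q)\sim_n(q,p'),\ p\ne p'\}=o(n^2)$; - $\mathbb E\,a_n(p,q)=0$ for all $n,p,q$; $\ \mathbb E|a_n(p,q)|^2=1$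 for all $n$ and all $(p,q)\in J_n^{\mathcal C}$; and $\sup_n\max_{p,q}\mathbb E|a_n(p,q)|^k<\infty$ for every $k\in\mathbb N$. Let $L_n=\frac1{\delta n}\sum_{j=1}^{\delta n}\delta_{\lambda_j}$ denote the empirical measure of the eigenvalues $\lambda_1,\dots,\lambda_{\delta n}$ of $X_n$. Then, as $n\to\infty$, the mean empirical eigenvalue distribution $\mathbb E(L_n)$ converges weakly to the semicircle law, which has density $\frac1{2\pi}1_{[-2,2]}(x)\sqrt{4-x^2}$. -/

import Mathlib

open MeasureTheory ProbabilityTheory Filter Topology Asymptotics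
open scoped ENNReal NNReal BoundedContinuousFunction

/-- The Wigner-Dyson classes (`A`, `AI`, `AII`) and the Bogolioubov-de Gennes classes
(`BD`, `C`, `CI`, `DIII`). -/
inductive SymClass where
  | A | AI | AII | BD | C | CI | DIII

namespace SymClass

/-- The factor `δ`: matrices of the class with parameter `n` have size `δ n × δ n`. -/
def delta : SymClass → ℕ
  | A | AI | BD => 1
  | AII | C | CI | DIII => 2

/-- Row and column indices. For the classes of `2 × 2` block matrices, the index set
`{1, …, 2n}` is realized as the disjoint union of its two halves. -/
def Index : SymClass → ℕ → Type
  | A, n | AI, n | BD, n => Fin n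
  | AII, n | C, n | CI, n | DIII, n => Fin n ⊕ Fin n

instance instFintypeIndex : (c : SymClass) → (n : ℕ) → Fintype (c.Index n)
  | A, n | AI, n | BD, n => inferInstanceAs (Fintype (Fin n))
  | AII, n | C, n | CI, n | DIII, n => inferInstanceAs (Fintype (Fin n ⊕ Fin n))

instance instDecidableEqIndex : (c : SymClass) → (n : ℕ) → DecidableEq (c.Index n)
  | A, n | AI, n | BD, n => inferInstanceAs (DecidableEq (Fin n))
  | AII, n | C, n | CI, n | DIII, n => inferInstanceAs (DecidableEq (Fin n ⊕ Fin n))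

theorem card_index (c : SymClass) (n : ℕ) : Fintype.card (c.Index n) = c.delta * n := by
  cases c
  case A => exact (Fintype.card_fin n).trans (one_mul n).symm
  case AI => exact (Fintype.card_fin n).trans (one_mul n).symm
  case BD => exact (Fintype.card_fin n).trans (one_mul n).symm
  all_goals
    exact (Fintype.card_sum (α := Fin n) (β := Fin n)).trans (by simp [delta, two_mul])

/-- All entries of the complex matrix are real. -/
def EntriesReal {ι : Type} (X : Matrix ι ι ℂ) : Prop := ∀ p q, (X p q).im = 0

/-- All entries of the complex matrix lie in `iℝ`. -/
def EntriesImaginary {ι : Type} (X : Matrix ι ι ℂ) : Prop := ∀ p q, (X p q).re = 0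

/-- The space of matrices belonging to each class. Here `Xᵀ = X` is symmetry, `Xᵀ = -X` is skew
symmetry, and `X.map star` is the entrywise complex conjugate. -/
def space : (c : SymClass) → (n : ℕ) → Set (Matrix (c.Index n) (c.Index n) ℂ)
  | A, n => {X : Matrix (Fin n) (Fin n) ℂ | X.IsHermitian}
  | AI, n => {X : Matrix (Fin n) (Fin n) ℂ | EntriesReal X ∧ X.transpose = X}
  | AII, n => {M : Matrix (Fin n ⊕ Fin n) (Fin n ⊕ Fin n) ℂ |
      ∃ X₁ X₂ : Matrix (Fin n) (Fin n) ℂ, X₁.IsHermitian ∧ X₂.transpose = -X₂ ∧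
        M = Matrix.fromBlocks X₁ X₂ (-(X₂.map star)) (X₁.map star)}
  | BD, n => {X : Matrix (Fin n) (Fin n) ℂ | EntriesImaginary X ∧ X.transpose = -X}
  | C, n => {M : Matrix (Fin n ⊕ Fin n) (Fin n ⊕ Fin n) ℂ |
      ∃ X₁ X₂ : Matrix (Fin n) (Fin n) ℂ, X₁.IsHermitian ∧ X₂.transpose = X₂ ∧
        M = Matrix.fromBlocks X₁ X₂ (X₂.map star) (-(X₁.map star))}
  | CI, n => {M : Matrix (Fin n ⊕ Fin n) (Fin n ⊕ Fin n) ℂ |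
      ∃ X₁ X₂ : Matrix (Fin n) (Fin n) ℂ, EntriesReal X₁ ∧ EntriesReal X₂ ∧
        X₁.transpose = X₁ ∧ X₂.transpose = X₂ ∧ M = Matrix.fromBlocks X₁ X₂ X₂ (-X₁)}
  | DIII, n => {M : Matrix (Fin n ⊕ Fin n) (Fin n ⊕ Fin n) ℂ |
      ∃ X₁ X₂ : Matrix (Fin n) (Fin n) ℂ, EntriesImaginary X₁ ∧ EntriesImaginary X₂ ∧
        X₁.transpose = -X₁ ∧ X₂.transpose = -X₂ ∧ M = Matrix.fromBlocks X₁ X₂ X₂ (-X₁)}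

/-- The index pairs at which not all matrices of the class vanish. -/
def support (c : SymClass) (n : ℕ) : Set (c.Index n × c.Index n) :=
  {t | ∃ M ∈ c.space n, M t.1 t.2 ≠ 0}

theorem conjTranspose_of_real {ι : Type} {X : Matrix ι ι ℂ} (h : EntriesReal X)
    (hs : X.transpose = X) : X.conjTranspose = X := by
  ext p q
  have h1 : X q p = X p q := congrFun (congrFun hs p) q
  rw [Matrix.conjTranspose_apply, h1]
  exact Complex.conj_eq_iff_im.2 (h p q)

theorem conjTranspose_of_imaginary {ι : Type} {X : Matrix ι ι ℂ} (h : EntriesImaginary X)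
    (hs : X.transpose = -X) : X.conjTranspose = X := by
  ext p q
  have h1 : X q p = -X p q := congrFun (congrFun hs p) q
  rw [Matrix.conjTranspose_apply, h1]
  apply Complex.ext <;> simp [h p q]

/-- Every matrix of each class is hermitian. -/
theorem isHermitian_of_mem {c : SymClass} {n : ℕ} {M : Matrix (c.Index n) (c.Index n) ℂ}
    (hM : M ∈ c.space n) : M.IsHermitian := by
  cases c
  case A => exact hM
  case AI => exact conjTranspose_of_real hM.1 hM.2
  case BD => exact conjTranspose_of_imaginary hM.1 hM.2
  case AII =>
    obtain ⟨X₁, X₂, h₁, h₂, rfl⟩ := hM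
    have e : ∀ p q, X₂ q p = -X₂ p q := fun p q => congrFun (congrFun h₂ p) q
    refine Matrix.IsHermitian.fromBlocks h₁ ?_ ?_
    · ext p q
      simp [Matrix.conjTranspose_apply, e p q]
    · ext p q
      simpa [Matrix.conjTranspose_apply] using (congrArg star (h₁.apply p q))
  case C =>
    obtain ⟨X₁, X₂, h₁, h₂, rfl⟩ := hM
    have e : ∀ p q, X₂ q p = X₂ p q := fun p q => congrFun (congrFun h₂ p) q
    refine Matrix.IsHermitian.fromBlocks h₁ ?_ ?_
    · ext p q
      simp [Matrix.conjTranspose_apply, e p q]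
    · ext p q
      simpa [Matrix.conjTranspose_apply] using (congrArg star (h₁.apply p q))
  case CI =>
    obtain ⟨X₁, X₂, r₁, r₂, h₁, h₂, rfl⟩ := hM
    have e₁ := conjTranspose_of_real r₁ h₁
    exact Matrix.IsHermitian.fromBlocks e₁ (conjTranspose_of_real r₂ h₂)
      (Matrix.IsHermitian.neg e₁)
  case DIII =>
    obtain ⟨X₁, X₂, r₁, r₂, h₁, h₂, rfl⟩ := hM
    have e₁ := conjTranspose_of_imaginary r₁ h₁
    exact Matrix.IsHermitian.fromBlocks e₁ (conjTranspose_of_imaginary r₂ h₂)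
      (Matrix.IsHermitian.neg e₁)

end SymClass

/-! The three conditions on a sequence of equivalence relations on pairs of indices; `ι n` is the
index set of the `n`-th matrix, and the `o`-terms refer to the square of its size. -/

/-- `max_p #{(q, p', q') : (p, q) ∼ (p', q')} = o(size²)`. -/
def ConditionW1 (ι : ℕ → Type) [∀ n, Fintype (ι n)] (r : ∀ n, Setoid (ι n × ι n)) : Prop :=
  (fun n => ((Finset.univ.sup fun p : ι n =>
      {t : ι n × ι n × ι n | r n (p, t.1) (t.2.1, t.2.2)}.ncard : ℕ) : ℝ))
    =o[atTop] fun n => (Fintype.card (ι n) : ℝ) ^ 2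

/-- `max_{p, q, p'} #{q' : (p, q) ∼ (p', q')} ≤ B` for a finite constant `B`. -/
def ConditionW2 (ι : ℕ → Type) (r : ∀ n, Setoid (ι n × ι n)) : Prop :=
  ∃ B : ℕ, ∀ n, ∀ p q p' : ι n, {q' : ι n | r n (p, q) (p', q')}.ncard ≤ B

/-- `#{(p, q, p') : (p, q) ∼ (q, p') and p ≠ p'} = o(size²)`. -/
def ConditionW3 (ι : ℕ → Type) [∀ n, Fintype (ι n)] (r : ∀ n, Setoid (ι n × ι n)) : Prop :=
  (fun n => ({t : ι n × ι n × ι n |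
      r n (t.1, t.2.1) (t.2.1, t.2.2) ∧ t.1 ≠ t.2.2}.ncard : ℝ))
    =o[atTop] fun n => (Fintype.card (ι n) : ℝ) ^ 2

/-- The empirical measure of the eigenvalues of a hermitian matrix. -/
noncomputable def empiricalMeasure {ι : Type} [Fintype ι] [DecidableEq ι]
    (M : Matrix ι ι ℂ) (hM : M.IsHermitian) : Measure ℝ :=
  (Fintype.card ι : ℝ≥0∞)⁻¹ • ∑ j, Measure.dirac (hM.eigenvalues j)

/-- The mean empirical eigenvalue distribution `B ↦ 𝔼 (L(X)(B))` of a random hermitian matrix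
`X`, where `L` is the empirical measure. -/
noncomputable def meanEmpiricalMeasure {ι : Type} [Fintype ι] [DecidableEq ι]
    {Ω : Type*} [MeasurableSpace Ω] (P : Measure Ω)
    (X : Ω → Matrix ι ι ℂ) (hX : ∀ ω, (X ω).IsHermitian) : Measure ℝ :=
  P.bind fun ω => empiricalMeasure (X ω) (hX ω)

/-- Weak convergence of a sequence of measures on `ℝ`. -/
def ConvergesWeakly (μ : ℕ → Measure ℝ) (ν : Measure ℝ) : Prop :=
  ∀ f : ℝ →ᵇ ℝ, Tendsto (fun n => ∫ x, f x ∂(μ n)) atTop (𝓝 (∫ x, f x ∂ν))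

/-- The random matrix `(N^{-1/2} a(p, q))_{p, q}` with `N` the size of the matrix. -/
noncomputable def scaledMatrix {ι : Type} [Fintype ι] {Ω : Type*} (a : ι → ι → Ω → ℂ) (ω : Ω) :
    Matrix ι ι ℂ :=
  Matrix.of fun p q => ((1 / Real.sqrt (Fintype.card ι) : ℝ) : ℂ) * a p q ω

/-- The semicircle law, with density `(2π)⁻¹ 1_{[-2,2]}(x) √(4 - x²)`. -/
noncomputable def semicircleLaw : Measure ℝ :=
  volume.withDensity fun x => ENNReal.ofReal
    (1 / (2 * Real.pi) * (Set.Icc (-2 : ℝ) 2).indicator (fun x => Real.sqrt (4 - x ^ 2)) x)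

/-! The proof is the method of moments. With `N` the size of the matrix and `A` the unscaled matrix,
the `k`-th moment of the mean empirical distribution is `N^(-k/2-1)` times the expectation of `tr
A^k`, which is a sum over closed walks with `k` steps of expected products of entries. By
independence and centering, a walk contributes only if every equivalence class among its edges is
met at least twice. By (W2) there are `O(N^(u+1))` walks with `u` classes, so only walks with
exactly `k/2` classes, each met twice, can survive in the limit.

Among these the relevant ones are the tree walks (`TreeWalk`), which either open a new class or
retrace the last open edge. A walk that meets no class three times and is not a tree walk has a
first step that leaves the pattern: it enters a class of an open edge without retracing the last one
(`Exceptional.step`). If that open edge lies deeper in the stack, (W1) makes such steps rare; if it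
is the last one, (W3) does. Either way a factor `o(1)` is gained (`listCount_exceptional_le`). A
complete tree walk contributes exactly `1`, because its product splits into factors `|a(p,q)|^2`
from inequivalent pairs. The relation `(p,q) ∼ (q,p)` on the support, used throughout, is forced by
independence and unit variance (`equiv_swap`).

A tree walk can be extended by `N - O(1)` new edges or by one retracing step, so the normalized
counts converge to the solution `ballot` of a two-term recurrence (`tendsto_treeCount`). After the
substitution `x = 2 cos θ`, the semicircle moments obey the same recurrence
(`integral_two_cos_pow_mul_sin_mul_sin`), so no closed formula for Catalan numbers is needed. The
symmetry classes enter only through hermiticity and the fact that each row has at most two forced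
zeros. -/

/-! ### Walks and the equivalence classes of their edges -/

section Lists

open scoped Classical

variable {ι : Type}

/-- The edges of the walk whose vertices are listed in reverse order, the most recent first. -/
def edges (l : List ι) : List (ι × ι) := l.tail.zip l

@[simp] theorem edges_nil : edges ([] : List ι) = [] := rfl

@[simp] theorem edges_singleton (p : ι) : edges [p] = [] := rfl

@[simp] theorem edges_cons_cons (q p : ι) (l : List ι) :
    edges (q :: p :: l) = (p, q) :: edges (p :: l) := rfl

theorem length_edges (l : List ι) : (edges l).length = l.length - 1 := by
  simp [edges]

variable (r : Setoid (ι × ι))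

/-- The list of equivalence classes of the edges of a walk. -/
def classList (l : List ι) : List (Quotient r) := (edges l).map (Quotient.mk r)

@[simp] theorem classList_cons_cons (q p : ι) (l : List ι) :
    classList r (q :: p :: l) = Quotient.mk r (p, q) :: classList r (p :: l) := rfl

@[simp] theorem classList_singleton (p : ι) : classList r [p] = [] := rfl

theorem mem_classList {l : List ι} {e : ι × ι} :
    Quotient.mk r e ∈ classList r l ↔ ∃ e' ∈ edges l, r e' e := by
  simp only [classList, List.mem_map]
  exact exists_congr fun e' => and_congr_right fun _ => Quotient.eq

/-- The number of equivalence classes met by a walk. -/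
noncomputable def numClasses (l : List ι) : ℕ := (classList r l).toFinset.card

theorem numClasses_cons_cons (q p : ι) (l : List ι) :
    numClasses r (q :: p :: l) = if ∃ e ∈ edges (p :: l), r e (p, q) then numClasses r (p :: l)
      else numClasses r (p :: l) + 1 := by
  split_ifs with h <;> rw [← mem_classList] at h <;> simp [numClasses, h]

variable [Fintype ι]

/-- The finite set of lists of a given length. -/
noncomputable def listsOfLength (ι : Type) [Fintype ι] : ℕ → Finset (List ι)
  | 0 => {[]}
  | k + 1 => (Finset.univ ×ˢ listsOfLength ι k).image fun x => x.1 :: x.2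

theorem mem_listsOfLength {k : ℕ} {l : List ι} : l ∈ listsOfLength ι k ↔ l.length = k := by
  induction k generalizing l with
  | zero => simp [listsOfLength]
  | succ k ih =>
    cases l with
    | nil => simp [listsOfLength]
    | cons q l => simp [listsOfLength, ih]

theorem sum_listsOfLength_succ {M : Type*} [AddCommMonoid M] (f : List ι → M) (k : ℕ) :
    ∑ l ∈ listsOfLength ι (k + 1), f l = ∑ l ∈ listsOfLength ι k, ∑ q, f (q :: l) := by
  rw [listsOfLength, Finset.sum_image, Finset.sum_product, Finset.sum_comm]
  rintro ⟨a, b⟩ _ ⟨c, d⟩ _ h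
  simpa using h

/-- The number of lists of length `k` with the property `p`. -/
noncomputable def listCount (k : ℕ) (p : List ι → Prop) : ℕ :=
  ((listsOfLength ι k).filter p).card

theorem listCount_eq_sum (k : ℕ) (p : List ι → Prop) :
    listCount k p = ∑ l ∈ listsOfLength ι k, if p l then 1 else 0 := by
  rw [listCount, Finset.card_filter]

theorem listCount_succ (k : ℕ) (p : List ι → Prop) :
    listCount (k + 1) p =
      ∑ l ∈ listsOfLength ι k, (Finset.univ.filter fun q => p (q :: l)).card := by
  rw [listCount_eq_sum, sum_listsOfLength_succ]
  exact Finset.sum_congr rfl fun l _ => (Finset.card_filter _ _).symm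

theorem listCount_mono {k : ℕ} {p p' : List ι → Prop}
    (h : ∀ l, l.length = k → p l → p' l) : listCount k p ≤ listCount k p' := by
  refine Finset.card_le_card fun l hl => ?_
  rw [Finset.mem_filter, mem_listsOfLength] at *
  exact ⟨hl.1, h l hl.1 hl.2⟩

theorem listCount_or_le (k : ℕ) (p p' : List ι → Prop) :
    listCount k (fun l => p l ∨ p' l) ≤ listCount k p + listCount k p' := by
  refine (Finset.card_le_card fun l hl => ?_).trans (Finset.card_union_le _ _)
  simpa [← and_or_left] using hl

theorem listCount_eq_zero {k : ℕ} {p : List ι → Prop} (h : ∀ l, l.length = k → ¬p l) :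
    listCount k p = 0 := by
  rw [listCount, Finset.card_eq_zero, Finset.filter_eq_empty_iff]
  exact fun l hl => h l (mem_listsOfLength.1 hl)

theorem card_listsOfLength (k : ℕ) : (listsOfLength ι k).card = Fintype.card ι ^ k := by
  induction k with
  | zero => simp [listsOfLength]
  | succ k ih =>
    rw [Finset.card_eq_sum_ones, sum_listsOfLength_succ]
    simp [ih, pow_succ]

theorem listCount_le_pow (k : ℕ) (p : List ι → Prop) : listCount k p ≤ Fintype.card ι ^ k :=
  (Finset.card_filter_le _ _).trans (card_listsOfLength k).le

theorem card_filter_exists_edge_le {B : ℕ}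
    (hB : ∀ p q p' : ι, {q' : ι | r (p, q) (p', q')}.ncard ≤ B) (p : ι) (L : List (ι × ι)) :
    (Finset.univ.filter fun q => ∃ e ∈ L, r e (p, q)).card ≤ L.length * B := by
  induction L with
  | nil => simp
  | cons e L ih =>
    have : (Finset.univ.filter fun q => ∃ e' ∈ e :: L, r e' (p, q)) =
        (Finset.univ.filter fun q => r e (p, q)) ∪
          Finset.univ.filter fun q => ∃ e' ∈ L, r e' (p, q) := by
      ext q
      simp
    rw [this]
    refine (Finset.card_union_le _ _).trans ?_
    have h1 := hB e.1 e.2 p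
    rw [Set.ncard_eq_toFinset_card'] at h1
    simp only [Set.toFinset_ofPred, Prod.mk.eta] at h1
    rw [List.length_cons, add_mul, one_mul, add_comm]
    exact add_le_add ih h1

/-- Extending walks by one step: a step to a new class has at most `card ι` choices, a step to a
class met before has boundedly many. -/
theorem listCount_tail_numClasses_le {B : ℕ}
    (hB : ∀ p q p' : ι, {q' : ι | r (p, q) (p', q')}.ncard ≤ B) (P : List ι → Prop) (k u : ℕ) :
    listCount (k + 2) (fun l => P l.tail ∧ numClasses r l = u) ≤
      Fintype.card ι * listCount (k + 1) (fun l => P l ∧ numClasses r l + 1 = u) +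
        k * B * listCount (k + 1) (fun l => P l ∧ numClasses r l = u) := by
  rw [listCount_succ, listCount_eq_sum, listCount_eq_sum, Finset.mul_sum, Finset.mul_sum,
    ← Finset.sum_add_distrib]
  refine Finset.sum_le_sum fun l hl => ?_
  rw [mem_listsOfLength] at hl
  obtain ⟨p, l, rfl⟩ := List.exists_cons_of_length_eq_add_one hl
  simp only [List.tail_cons, numClasses_cons_cons]
  by_cases hP : P (p :: l)
  · simp only [hP, true_and]
    by_cases h1 : numClasses r (p :: l) + 1 = u
    · rw [if_pos h1, mul_one]
      exact (Finset.card_le_univ _).trans (Nat.le_add_right _ _)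
    · by_cases h2 : numClasses r (p :: l) = u
      · rw [if_neg h1, if_pos h2, mul_zero, zero_add, mul_one]
        have h3 := card_filter_exists_edge_le r hB p (edges (p :: l))
        rw [length_edges, hl, Nat.add_sub_cancel] at h3
        refine (Finset.card_le_card fun q hq => ?_).trans h3
        rw [Finset.mem_filter] at *
        refine ⟨hq.1, ?_⟩
        by_contra h
        rw [if_neg h] at hq
        exact h1 hq.2
      · rw [Finset.card_eq_zero.2]
        · exact Nat.zero_le _
        · rw [Finset.filter_eq_empty_iff]
          intro q _
          split_ifs <;> assumption
  · simp [hP]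

/-- Besides the starting vertex, only a step into a new class has a free endpoint; a step into an
old class has at most `k * B` choices. Hence the exponent `u + 1`. -/
theorem listCount_numClasses_le {B : ℕ}
    (hB : ∀ p q p' : ι, {q' : ι | r (p, q) (p', q')}.ncard ≤ B) (k u : ℕ) :
    listCount (k + 1) (fun l => numClasses r l = u) ≤
      (1 + k * B) ^ k * Fintype.card ι ^ (u + 1) := by
  induction k generalizing u with
  | zero =>
    rcases Nat.eq_zero_or_pos u with rfl | hu
    · simpa using listCount_le_pow (ι := ι) 1 _
    · rw [listCount_eq_zero]
      · exact Nat.zero_le _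
      · intro l hl
        obtain ⟨p, rfl⟩ := List.length_eq_one_iff.1 hl
        simpa [numClasses] using hu.ne
  | succ k ih =>
    have h := listCount_tail_numClasses_le r hB (fun _ => True) k u
    simp only [true_and] at h
    have h2 := ih u
    have h1 : Fintype.card ι * listCount (k + 1) (fun l : List ι => numClasses r l + 1 = u) ≤
        (1 + k * B) ^ k * Fintype.card ι ^ (u + 1) := by
      cases u with
      | zero => simp [listCount]
      | succ u =>
        simp only [add_left_inj]
        calc _ ≤ Fintype.card ι * ((1 + k * B) ^ k * Fintype.card ι ^ (u + 1)) :=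
              Nat.mul_le_mul_left _ (ih u)
          _ = _ := by ring
    calc _ ≤ _ := h
      _ ≤ (1 + k * B) ^ k * Fintype.card ι ^ (u + 1) +
          k * B * ((1 + k * B) ^ k * Fintype.card ι ^ (u + 1)) :=
        add_le_add h1 (Nat.mul_le_mul_left _ h2)
      _ = (1 + k * B) ^ (k + 1) * Fintype.card ι ^ (u + 1) := by ring
      _ ≤ _ := by gcongr; omega

end Lists

/-! ### Tree walks -/

/-- `TreeWalk r S l s`: each step of the walk `l` either passes an edge of `S` of a new equivalence
class, or goes back along the last edge that has not yet been traversed back. The second argument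
is the stack of vertices on the path that remains to be traversed back. -/
inductive TreeWalk {ι : Type} (r : Setoid (ι × ι)) (S : Set (ι × ι)) : List ι → List ι → Prop
  | start (p : ι) : TreeWalk r S [p] [p]
  | push {p q : ι} {l s : List ι} : TreeWalk r S (p :: l) (p :: s) → (p, q) ∈ S →
      (∀ e ∈ edges (p :: l), ¬r e (p, q)) → TreeWalk r S (q :: p :: l) (q :: p :: s)
  | pop {p q : ι} {l s : List ι} : TreeWalk r S (p :: l) (p :: q :: s) →
      TreeWalk r S (q :: p :: l) (q :: s)

namespace TreeWalk

open scoped Classical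

variable {ι : Type} {r : Setoid (ι × ι)} {S : Set (ι × ι)} {l s : List ι}

theorem exists_cons (h : TreeWalk r S l s) : ∃ p l' s', l = p :: l' ∧ s = p :: s' := by
  cases h <;> exact ⟨_, _, _, rfl, rfl⟩

theorem edges_subset (h : TreeWalk r S l s) : ∀ e ∈ edges s, e ∈ edges l := by
  induction h with
  | start p => simp
  | push _ _ _ ih =>
    intro e he
    rw [edges_cons_cons, List.mem_cons] at *
    exact he.imp id (ih e)
  | pop _ ih =>
    intro e he
    rw [edges_cons_cons]
    exact List.mem_cons_of_mem _ (ih e (by rw [edges_cons_cons]; exact List.mem_cons_of_mem _ he))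

theorem edges_stack_mem (h : TreeWalk r S l s) : ∀ e ∈ edges s, e ∈ S := by
  induction h with
  | start p => simp
  | push _ hS _ ih =>
    intro e he
    rw [edges_cons_cons, List.mem_cons] at he
    rcases he with rfl | he
    · exact hS
    · exact ih e he
  | pop _ ih =>
    exact fun e he => ih e (by rw [edges_cons_cons]; exact List.mem_cons_of_mem _ he)

/-- A step back along the last edge leads to an equivalence class met before. -/
theorem exists_equiv_of_pop (hswap : ∀ p q, (p, q) ∈ S → r (p, q) (q, p)) {p q : ι}
    (h : TreeWalk r S (p :: l) (p :: q :: s)) : ∃ e ∈ edges (p :: l), r e (p, q) := by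
  have h0 : (q, p) ∈ edges (p :: q :: s) := by simp
  exact ⟨(q, p), h.edges_subset _ h0, hswap _ _ (h.edges_stack_mem _ h0)⟩

/-- A push enters a new class, whereas a pop enters an old one because opposite edges are
equivalent. So the walk itself decides which of the two each step was. -/
theorem stack_unique (hswap : ∀ p q, (p, q) ∈ S → r (p, q) (q, p)) (h : TreeWalk r S l s) :
    ∀ {s'}, TreeWalk r S l s' → s = s' := by
  induction h with
  | start p =>
    intro s' h'
    cases h'
    rfl
  | push h _ hn ih =>
    intro s' h'
    cases h' with
    | push h' => rw [ih h']
    | pop h' =>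
      obtain ⟨e, he, hr⟩ := h'.exists_equiv_of_pop hswap
      exact absurd hr (hn e he)
  | pop h ih =>
    intro s' h'
    cases h' with
    | push h' _ hn =>
      obtain ⟨e, he, hr⟩ := h.exists_equiv_of_pop hswap
      exact absurd hr (hn e he)
    | pop h' => exact (List.cons.inj (ih h')).2

/-- A push adds one to the length, the stack and the class count; a pop adds one to the length and
removes one from the stack. -/
theorem two_mul_numClasses (hswap : ∀ p q, (p, q) ∈ S → r (p, q) (q, p))
    (h : TreeWalk r S l s) : 2 * numClasses r l + 2 = l.length + s.length := by
  induction h with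
  | start p => simp [numClasses]
  | push h _ hn ih =>
    rw [numClasses_cons_cons, if_neg (by push Not; exact hn)]
    simp only [List.length_cons] at *
    omega
  | pop h ih =>
    rw [numClasses_cons_cons, if_pos (h.exists_equiv_of_pop hswap)]
    simp only [List.length_cons] at *
    omega

theorem length_stack_le (h : TreeWalk r S l s) : s.length ≤ l.length := by
  induction h with
  | start p => rfl
  | push h _ hn ih => simp only [List.length_cons] at *; omega
  | pop h ih => simp only [List.length_cons] at *; omega

/-- An edge of a tree walk is equivalent to an edge that remains to be traversed back, or its class
has been met twice. -/
theorem equiv_stack_or_two_le_count (hswap : ∀ p q, (p, q) ∈ S → r (p, q) (q, p))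
    (h : TreeWalk r S l s) : ∀ e ∈ edges l,
      (∃ e' ∈ edges s, r e' e) ∨ 2 ≤ (classList r l).count (Quotient.mk r e) := by
  induction h with
  | start p => simp
  | push h _ hn ih =>
    intro e he
    rw [edges_cons_cons, List.mem_cons] at he
    rcases he with rfl | he
    · exact Or.inl ⟨_, by rw [edges_cons_cons]; exact List.mem_cons_self, r.refl _⟩
    · refine (ih e he).imp ?_ ?_
      · rintro ⟨e', he', hr⟩
        exact ⟨e', by rw [edges_cons_cons]; exact List.mem_cons_of_mem _ he', hr⟩
      · intro h2
        rw [classList_cons_cons]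
        exact h2.trans List.count_le_count_cons
  | @pop p q l s h ih =>
    obtain ⟨e₀, he₀, hr₀⟩ := h.exists_equiv_of_pop hswap
    have h1 : 1 ≤ (classList r (p :: l)).count (Quotient.mk r (p, q)) :=
      List.one_le_count_iff.2 ((mem_classList r).2 ⟨e₀, he₀, hr₀⟩)
    have h2 : 2 ≤ (classList r (q :: p :: l)).count (Quotient.mk r (p, q)) := by
      rw [classList_cons_cons, List.count_cons_self]
      omega
    intro e he
    by_cases hpq : r (p, q) e
    · right
      rwa [← Quotient.sound hpq]
    · rw [edges_cons_cons, List.mem_cons] at he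
      rcases he with rfl | he
      · exact absurd (r.refl _) hpq
      rcases ih e he with ⟨e', he', hr⟩ | h3
      · rw [edges_cons_cons, List.mem_cons] at he'
        rcases he' with rfl | he'
        · have h0 : (q, p) ∈ S := h.edges_stack_mem _ (by simp)
          exact absurd (r.trans (r.symm (hswap _ _ h0)) hr) hpq
        · exact Or.inl ⟨e', he', hr⟩
      · right
        rw [classList_cons_cons]
        exact h3.trans List.count_le_count_cons

/-- Along a tree walk, the edges are, up to order, those of the stack and pairs of opposite edges
of distinct equivalence classes. -/
theorem exists_prod_eq (h : TreeWalk r S l s) : ∃ F : List (ι × ι),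
    (∀ e ∈ F ++ edges s, e ∈ S ∧ e ∈ edges l) ∧ (F ++ edges s).Pairwise (fun e e' => ¬r e e') ∧
    ∀ {M : Type} [CommMonoid M] (f : ι × ι → M), ((edges l).map f).prod =
      (F.map fun e => f e * f e.swap).prod * ((edges s).map f).prod := by
  induction h with
  | start p => exact ⟨[], by simp, by simp, by simp⟩
  | @push p q l s h hS hn ih =>
    obtain ⟨F, h1, h2, h3⟩ := ih
    have hp : (F ++ (p, q) :: edges (p :: s)).Perm ((p, q) :: (F ++ edges (p :: s))) :=
      List.perm_middle
    refine ⟨F, ?_, ?_, ?_⟩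
    · intro e he
      rw [edges_cons_cons, hp.mem_iff, List.mem_cons] at he
      rw [edges_cons_cons]
      rcases he with rfl | he
      · exact ⟨hS, List.mem_cons_self⟩
      · exact ⟨(h1 e he).1, List.mem_cons_of_mem _ (h1 e he).2⟩
    · rw [edges_cons_cons, hp.pairwise_iff (fun {a b} h hr => h (r.symm hr)), List.pairwise_cons]
      exact ⟨fun e he hr => hn e (h1 e he).2 (r.symm hr), h2⟩
    · intro M _ f
      simp only [edges_cons_cons, List.map_cons, List.prod_cons, h3 f]
      exact mul_left_comm _ _ _
  | @pop p q l s h ih =>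
    obtain ⟨F, h1, h2, h3⟩ := ih
    have hp : (F ++ (q, p) :: edges (q :: s)).Perm ((q, p) :: F ++ edges (q :: s)) :=
      List.perm_middle
    refine ⟨(q, p) :: F, ?_, ?_, ?_⟩
    · intro e he
      rw [← hp.mem_iff, ← edges_cons_cons] at he
      rw [edges_cons_cons]
      exact ⟨(h1 e he).1, List.mem_cons_of_mem _ (h1 e he).2⟩
    · rwa [← hp.pairwise_iff (fun {a b} h hr => h (r.symm hr)), ← edges_cons_cons]
    · intro M _ f
      rw [edges_cons_cons, List.map_cons, List.prod_cons, h3 f]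
      simp only [edges_cons_cons, List.map_cons, List.prod_cons, Prod.swap_prod_mk]
      simp only [mul_left_comm, mul_comm, mul_assoc]

/-- The starting vertex always stays at the bottom of the stack; hence a tree walk whose stack is a
single vertex is closed. -/
theorem getLast_eq (h : TreeWalk r S l s) : l.getLast? = s.getLast? := by
  induction h with
  | start p => rfl
  | push h _ _ ih => rwa [List.getLast?_cons_cons, List.getLast?_cons_cons]
  | pop h ih => rw [List.getLast?_cons_cons, ih, List.getLast?_cons_cons]

end TreeWalk

/-! ### Bounds for tree walks and for stray steps -/

section TreeWalkCounting

open scoped Classical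

variable {ι : Type} [Fintype ι] (r : Setoid (ι × ι)) (S : Set (ι × ι))

/-- The number of tree walks with a given final stack. -/
theorem listCount_treeWalk_stack_le (k : ℕ) (s : List ι) (e : ℕ) (h : 2 * e + s.length = k + 1) :
    listCount (k + 1) (fun l => TreeWalk r S l s) ≤ 2 ^ k * Fintype.card ι ^ e := by
  induction k generalizing s e with
  | zero =>
    rcases s with _ | ⟨p, s⟩
    · rw [listCount_eq_zero]
      · exact Nat.zero_le _
      · intro l _ hl
        obtain ⟨p, l', s', -, h⟩ := hl.exists_cons
        simp at h
    · have he : e = 0 := by simp only [List.length_cons] at h; omega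
      subst he
      rw [listCount_succ]
      simp only [listsOfLength, Finset.sum_singleton, pow_zero, mul_one]
      rw [Finset.card_le_one]
      have hp : ∀ a, TreeWalk r S [a] (p :: s) → a = p := by
        intro a ha
        cases ha
        rfl
      intro a ha b hb
      rw [Finset.mem_filter] at ha hb
      rw [hp a ha.2, hp b hb.2]
  | succ k ih =>
    rcases s with _ | ⟨q, t⟩
    · rw [listCount_eq_zero]
      · exact Nat.zero_le _
      · intro l _ hl
        obtain ⟨p, l', s', -, h⟩ := hl.exists_cons
        simp at h
    · have h1 : listCount (k + 1) (fun l => TreeWalk r S l t) ≤ 2 ^ k * Fintype.card ι ^ e :=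
        ih t e (by simp only [List.length_cons] at h; omega)
      -- Here `e` is the number of pops. If the last step was a pop, the vertex `a` just left is
      -- free, which costs one factor of the cardinality and uses up one pop; for `e = 0` the stack
      -- would be longer than the walk.
      have h2 : ∑ a, listCount (k + 1) (fun l => TreeWalk r S l (a :: q :: t)) ≤
          2 ^ k * Fintype.card ι ^ e := by
        cases e with
        | zero =>
          rw [Finset.sum_eq_zero]
          · exact Nat.zero_le _
          · intro a _
            apply listCount_eq_zero
            intro l hl hw
            have := hw.length_stack_le
            simp only [List.length_cons] at this h
            omega
        | succ e =>
          calc _ ≤ ∑ a : ι, 2 ^ k * Fintype.card ι ^ e := by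
                refine Finset.sum_le_sum fun a _ => ih _ _ ?_
                simp only [List.length_cons] at h ⊢
                omega
            _ = _ := by
              rw [Finset.sum_const, Finset.card_univ, smul_eq_mul]
              ring
      -- The final stack determines the last vertex, so only the type of the last step is open;
      -- these two alternatives produce the factor `2 ^ k`.
      have h3 : listCount (k + 2) (fun l => TreeWalk r S l (q :: t)) ≤
          listCount (k + 1) (fun l => TreeWalk r S l t) +
            ∑ a, listCount (k + 1) (fun l => TreeWalk r S l (a :: q :: t)) := by
        simp only [listCount_eq_sum (k + 1)]
        rw [listCount_succ, Finset.sum_comm, ← Finset.sum_add_distrib]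
        refine Finset.sum_le_sum fun l hlm => ?_
        have hx : ∀ x, TreeWalk r S (x :: l) (q :: t) →
            x = q ∧ (TreeWalk r S l t ∨ ∃ a, TreeWalk r S l (a :: q :: t)) := by
          intro x hx
          cases hx with
          | start => simp [mem_listsOfLength] at hlm
          | push hx _ _ => exact ⟨rfl, Or.inl hx⟩
          | pop hx => exact ⟨rfl, Or.inr ⟨_, hx⟩⟩
        by_cases hl : TreeWalk r S l t ∨ ∃ a, TreeWalk r S l (a :: q :: t)
        · have hc : (Finset.univ.filter fun x => TreeWalk r S (x :: l) (q :: t)).card ≤ 1 := by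
            rw [Finset.card_le_one]
            intro a ha b hb
            rw [Finset.mem_filter] at ha hb
            rw [(hx a ha.2).1, (hx b hb.2).1]
          refine hc.trans ?_
          rcases hl with hl | ⟨a, hl⟩
          · rw [if_pos hl]
            exact Nat.le_add_right _ _
          · refine le_trans ?_ (Nat.le_add_left _ _)
            refine le_trans ?_ (Finset.single_le_sum (fun i _ => Nat.zero_le _)
              (Finset.mem_univ a))
            rw [if_pos hl]
        · rw [Finset.card_eq_zero.2]
          · exact Nat.zero_le _
          · rw [Finset.filter_eq_empty_iff]
            exact fun x _ h => hl (hx x h).2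
      calc _ ≤ _ := h3
        _ ≤ 2 ^ k * Fintype.card ι ^ e + 2 ^ k * Fintype.card ι ^ e := add_le_add h1 h2
        _ = _ := by ring

/-- The number of lists in which some edge has a given property. -/
theorem listCount_exists_edge_le (R : ι × ι → Prop) (k : ℕ) :
    Fintype.card ι ^ 2 * listCount k (fun t => ∃ e ∈ edges t, R e) ≤
      k * Fintype.card ι ^ k * (Finset.univ.filter R).card := by
  induction k with
  | zero =>
    rw [listCount_eq_zero]
    · simp
    · intro l hl
      simp [List.length_eq_zero_iff.1 hl]
  | succ k ih =>
    cases k with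
    | zero =>
      rw [listCount_eq_zero]
      · simp
      · intro l hl
        obtain ⟨p, rfl⟩ := List.length_eq_one_iff.1 hl
        simp
    | succ k =>
      have h1 : listCount (k + 2) (fun t => ∃ e ∈ edges t, R e) ≤
          Fintype.card ι ^ k * (Finset.univ.filter R).card +
            Fintype.card ι * listCount (k + 1) (fun t => ∃ e ∈ edges t, R e) := by
        have h2 : Fintype.card ι ^ k * (Finset.univ.filter R).card =
            ∑ l ∈ listsOfLength ι k, ∑ p, ∑ q, if R (p, q) then 1 else 0 := by
          rw [← Fintype.sum_prod_type (f := fun x => if R x then 1 else 0)]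
          rw [Finset.sum_const, card_listsOfLength, smul_eq_mul, Finset.card_filter]
        rw [h2, listCount_succ, listCount_eq_sum (k + 1), Finset.mul_sum, sum_listsOfLength_succ,
          sum_listsOfLength_succ, ← Finset.sum_add_distrib]
        refine Finset.sum_le_sum fun l _ => ?_
        rw [← Finset.sum_add_distrib]
        refine Finset.sum_le_sum fun p _ => ?_
        by_cases h : ∃ e ∈ edges (p :: l), R e
        · rw [if_pos h, mul_one]
          exact (Finset.card_le_univ _).trans (Nat.le_add_left _ _)
        · rw [if_neg h, mul_zero, add_zero, Finset.card_filter]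
          refine Finset.sum_le_sum fun q _ => ?_
          by_cases hq : ∃ e ∈ edges (q :: p :: l), R e
          · have hR : R (p, q) := by
              obtain ⟨e, he, hR⟩ := hq
              rw [edges_cons_cons, List.mem_cons] at he
              rcases he with rfl | he
              · exact hR
              · exact absurd ⟨e, he, hR⟩ h
            rw [if_pos hq, if_pos hR]
          · rw [if_neg hq]
            exact Nat.zero_le _
      calc _ ≤ Fintype.card ι ^ 2 * _ := Nat.mul_le_mul_left _ h1
        _ = Fintype.card ι ^ (k + 2) * (Finset.univ.filter R).card + Fintype.card ι *
            (Fintype.card ι ^ 2 * listCount (k + 1) (fun t => ∃ e ∈ edges t, R e)) := by ring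
        _ ≤ Fintype.card ι ^ (k + 2) * (Finset.univ.filter R).card + Fintype.card ι *
            ((k + 1 : ℕ) * Fintype.card ι ^ (k + 1) * (Finset.univ.filter R).card) := by gcongr
        _ = _ := by ring

/-- The edge `(p, q)` is equivalent to an edge of `t`, or to the edge from the head of `t` to `p`
although it is not its reversal. -/
def Stray (t : List ι) (p q : ι) : Prop :=
  (∃ e ∈ edges t, r e (p, q)) ∨ ∃ p₁ ∈ t.head?, r (p₁, p) (p, q) ∧ p₁ ≠ q

/-- The number of pairs of equivalent pairs. -/
noncomputable def equivCount : ℕ :=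
  (Finset.univ.filter fun x : (ι × ι) × (ι × ι) => r x.1 x.2).card

/-- The number of paths of length two with equivalent edges which do not return. -/
noncomputable def pathCount : ℕ :=
  (Finset.univ.filter fun x : ι × ι × ι =>
    r (x.1, x.2.1) (x.2.1, x.2.2) ∧ x.1 ≠ x.2.2).card

/-- There are `m + 2` free vertices in `p`, `t`, `q`, so the trivial bound has exponent `m + 2`. An
equivalence between `(p, q)` and an edge of `t` replaces four free vertices by `ε * N ^ 3`; an
equivalence with the edge entering `p` replaces three by `ε * N ^ 2`. Both save a factor `N` and
gain `ε`. -/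
theorem sum_stray_le {ε : ℝ} (hN : 0 < Fintype.card ι)
    (h1 : (equivCount r : ℝ) ≤ ε * (Fintype.card ι : ℝ) ^ 3)
    (h3 : (pathCount r : ℝ) ≤ ε * (Fintype.card ι : ℝ) ^ 2) (m : ℕ) :
    ((∑ p, ∑ t ∈ listsOfLength ι m, (Finset.univ.filter fun q => Stray r t p q).card : ℕ) : ℝ) ≤
      (m + 1) * ε * (Fintype.card ι : ℝ) ^ (m + 1) := by
  have hN' : (0 : ℝ) < Fintype.card ι := by exact_mod_cast hN
  have a1 : Fintype.card ι ^ 2 * (∑ p, ∑ q, listCount m (fun t => ∃ e ∈ edges t, r e (p, q))) ≤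
      m * Fintype.card ι ^ m * equivCount r := by
    have : equivCount r = ∑ p, ∑ q, (Finset.univ.filter fun e => r e (p, q)).card := by
      rw [equivCount, Finset.card_filter, Fintype.sum_prod_type, Finset.sum_comm,
        Fintype.sum_prod_type]
      simp only [Finset.card_filter]
    rw [this, Finset.mul_sum, Finset.mul_sum]
    refine Finset.sum_le_sum fun p _ => ?_
    rw [Finset.mul_sum, Finset.mul_sum]
    exact Finset.sum_le_sum fun q _ => listCount_exists_edge_le _ m
  have a2 : Fintype.card ι * (∑ p, ∑ t ∈ listsOfLength ι m,
      (Finset.univ.filter fun q => ∃ p₁ ∈ t.head?, r (p₁, p) (p, q) ∧ p₁ ≠ q).card) ≤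
      Fintype.card ι ^ m * pathCount r := by
    cases m with
    | zero => simp [listsOfLength]
    | succ m =>
      rw [Finset.sum_comm, sum_listsOfLength_succ]
      simp only [List.head?_cons, Option.mem_some_iff, exists_eq_left']
      have : ∑ p₁, ∑ p, (Finset.univ.filter fun q => r (p₁, p) (p, q) ∧ p₁ ≠ q).card =
          pathCount r := by
        rw [pathCount, Finset.card_filter, Fintype.sum_prod_type]
        simp only [Fintype.sum_prod_type, Finset.card_filter]
      rw [this, Finset.sum_const, card_listsOfLength, smul_eq_mul, pow_succ]
      exact le_of_eq (by ring)
  have a3 : (∑ p, ∑ t ∈ listsOfLength ι m, (Finset.univ.filter fun q => Stray r t p q).card) ≤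
      (∑ p, ∑ q, listCount m (fun t => ∃ e ∈ edges t, r e (p, q))) +
      (∑ p, ∑ t ∈ listsOfLength ι m,
        (Finset.univ.filter fun q => ∃ p₁ ∈ t.head?, r (p₁, p) (p, q) ∧ p₁ ≠ q).card) := by
    rw [← Finset.sum_add_distrib]
    refine Finset.sum_le_sum fun p _ => ?_
    simp only [listCount_eq_sum]
    rw [Finset.sum_comm, ← Finset.sum_add_distrib]
    refine Finset.sum_le_sum fun t _ => ?_
    simp only [Finset.card_filter]
    rw [← Finset.sum_add_distrib]
    refine Finset.sum_le_sum fun q _ => ?_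
    by_cases h1 : ∃ e ∈ edges t, r e (p, q)
    · have hs : Stray r t p q := Or.inl h1
      rw [if_pos h1, if_pos hs]
      exact Nat.le_add_right _ _
    · by_cases h2 : ∃ p₁ ∈ t.head?, r (p₁, p) (p, q) ∧ p₁ ≠ q
      · have hs : Stray r t p q := Or.inr h2
        rw [if_pos h2, if_pos hs]
        exact Nat.le_add_left _ _
      · rw [if_neg (show ¬Stray r t p q from fun h => h.elim h1 h2)]
        exact Nat.zero_le _
  set A := ∑ p, ∑ q, listCount m (fun t => ∃ e ∈ edges t, r e (p, q))
  set C := ∑ p, ∑ t ∈ listsOfLength ι m,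
        (Finset.univ.filter fun q => ∃ p₁ ∈ t.head?, r (p₁, p) (p, q) ∧ p₁ ≠ q).card
  have b1 : (Fintype.card ι : ℝ) ^ 2 * A ≤ m * (Fintype.card ι : ℝ) ^ m * equivCount r := by
    exact_mod_cast a1
  have b2 : (Fintype.card ι : ℝ) * C ≤ (Fintype.card ι : ℝ) ^ m * pathCount r := by
    exact_mod_cast a2
  have c1 : (A : ℝ) ≤ m * ε * (Fintype.card ι : ℝ) ^ (m + 1) := by
    refine le_of_mul_le_mul_left ?_ (pow_pos hN' 2)
    calc _ ≤ _ := b1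
      _ ≤ m * (Fintype.card ι : ℝ) ^ m * (ε * (Fintype.card ι : ℝ) ^ 3) := by gcongr
      _ = _ := by ring
  have c2 : (C : ℝ) ≤ ε * (Fintype.card ι : ℝ) ^ (m + 1) := by
    refine le_of_mul_le_mul_left ?_ hN'
    calc _ ≤ _ := b2
      _ ≤ (Fintype.card ι : ℝ) ^ m * (ε * (Fintype.card ι : ℝ) ^ 2) := by gcongr
      _ = _ := by ring
  calc _ ≤ ((A + C : ℕ) : ℝ) := by exact_mod_cast a3
    _ ≤ _ := by push_cast; linarith

end TreeWalkCounting

/-! ### Exceptional walks are rare -/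

section ExceptionalWalks

open scoped Classical

variable {ι : Type} (r : Setoid (ι × ι)) (S : Set (ι × ι))

/-- A walk in `S` which meets no equivalence class more than twice, but is not a tree walk. -/
def Exceptional (l : List ι) : Prop :=
  (∀ e ∈ edges l, e ∈ S) ∧ (∀ c, (classList r l).count c ≤ 2) ∧ ∀ s, ¬TreeWalk r S l s

/-- Suppose the walk without its last step is a tree walk. The last step cannot enter a new class,
since it would be a push, nor a class already met twice. So its class is that of an edge still on
the stack, and if this is the top edge, the step does not reverse it, since it would be a pop. -/
theorem Exceptional.step {r : Setoid (ι × ι)} {S : Set (ι × ι)}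
    (hswap : ∀ p q, (p, q) ∈ S → r (p, q) (q, p)) {q p : ι}
    {l : List ι} (h : Exceptional r S (q :: p :: l)) : Exceptional r S (p :: l) ∨
      ∃ t, TreeWalk r S (p :: l) (p :: t) ∧ Stray r t p q ∧
        numClasses r (q :: p :: l) = numClasses r (p :: l) := by
  obtain ⟨h1, h2, h3⟩ := h
  by_cases hw : ∃ s, TreeWalk r S (p :: l) s
  · right
    obtain ⟨s, hs⟩ := hw
    obtain ⟨p', l', t, hp, rfl⟩ := hs.exists_cons
    obtain ⟨rfl, rfl⟩ := List.cons.inj hp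
    have hold : ∃ e ∈ edges (p :: l), r e (p, q) := by
      by_contra hn
      push Not at hn
      exact h3 _ (hs.push (h1 _ (by simp)) hn)
    refine ⟨t, hs, ?_, by rw [numClasses_cons_cons, if_pos hold]⟩
    obtain ⟨e, he, hr⟩ := hold
    rcases hs.equiv_stack_or_two_le_count hswap e he with ⟨e', he', hr'⟩ | hc
    · rcases t with _ | ⟨p₁, t⟩
      · simp at he'
      · rw [edges_cons_cons, List.mem_cons] at he'
        rcases he' with rfl | he'
        · refine Or.inr ⟨p₁, rfl, r.trans hr' hr, ?_⟩
          rintro rfl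
          exact h3 _ hs.pop
        · exact Or.inl ⟨e', he', r.trans hr' hr⟩
    · have := h2 (Quotient.mk r (p, q))
      rw [classList_cons_cons, List.count_cons_self, ← Quotient.sound hr] at this
      omega
  · left
    push Not at hw
    refine ⟨fun e he => h1 e (by rw [edges_cons_cons]; exact List.mem_cons_of_mem _ he),
      fun c => (List.count_le_count_cons).trans (h2 c), hw⟩

theorem sum_comm_pairs {α β γ δ : Type*} (s : Finset α) (t : Finset β) (u : Finset γ)
    (v : Finset δ) (f : α → β → γ → δ → ℕ) :
    ∑ a ∈ s, ∑ b ∈ t, ∑ c ∈ u, ∑ d ∈ v, f a b c d =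
      ∑ c ∈ u, ∑ d ∈ v, ∑ a ∈ s, ∑ b ∈ t, f a b c d := by
  calc _ = ∑ x ∈ s ×ˢ t, ∑ y ∈ u ×ˢ v, f x.1 x.2 y.1 y.2 := by simp only [Finset.sum_product]
    _ = ∑ y ∈ u ×ˢ v, ∑ x ∈ s ×ˢ t, f x.1 x.2 y.1 y.2 := Finset.sum_comm
    _ = _ := by simp only [Finset.sum_product]

variable [Fintype ι]

/-- The tree walk and the stray last vertex are coupled only through `p` and `t`, so for fixed `p`
and `t` the count is a product. The proposition `P` lets the caller carry numerical side conditions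
along. -/
theorem listCount_stray_le (k m : ℕ) (P : Prop) :
    listCount (k + 2) (fun l => ∃ q p l' t, l = q :: p :: l' ∧ TreeWalk r S (p :: l') (p :: t) ∧
        Stray r t p q ∧ t.length = m ∧ P) ≤
      ∑ p, ∑ t ∈ listsOfLength ι m, listCount (k + 1) (fun l => TreeWalk r S l (p :: t)) *
        (Finset.univ.filter fun q => Stray r t p q).card := by
  have : ∀ p t, listCount (k + 1) (fun l => TreeWalk r S l (p :: t)) *
        (Finset.univ.filter fun q => Stray r t p q).card =
      ∑ l ∈ listsOfLength ι (k + 1), ∑ q, if TreeWalk r S l (p :: t) ∧ Stray r t p q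
        then 1 else 0 := by
    intro p t
    rw [listCount_eq_sum, Finset.sum_mul]
    refine Finset.sum_congr rfl fun l _ => ?_
    rw [Finset.card_filter, Finset.mul_sum]
    refine Finset.sum_congr rfl fun q _ => ?_
    by_cases h1 : TreeWalk r S l (p :: t) <;> simp [h1]
  simp only [this]
  rw [listCount_eq_sum, sum_listsOfLength_succ, sum_comm_pairs]
  refine Finset.sum_le_sum fun l hl => Finset.sum_le_sum fun q _ => ?_
  split_ifs with h
  · obtain ⟨q', p, l', t, heq, hw, hs, ht, -⟩ := h
    obtain ⟨rfl, rfl⟩ := List.cons.inj heq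
    refine Finset.sum_pos' (fun _ _ => Nat.zero_le _) ⟨p, Finset.mem_univ p,
      Finset.sum_pos' (fun _ _ => Nat.zero_le _) ⟨t, mem_listsOfLength.2 ht, ?_⟩⟩
    rw [if_pos ⟨hw, hs⟩]
    exact one_pos
  · exact Nat.zero_le _

/-- Induction on the number of steps: either the walk was already exceptional, and extending it
costs no more than for general walks, or its last step is the first stray one, and then the gain `ε`
comes from `sum_stray_le`. The constant does not depend on the index set, the relation or `ε`. -/
theorem listCount_exceptional_le (B k : ℕ) : ∃ C : ℝ, 0 ≤ C ∧
    ∀ (ι : Type) [Fintype ι] (r : Setoid (ι × ι)) (S : Set (ι × ι)) (ε : ℝ),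
      0 < Fintype.card ι → 0 ≤ ε → (∀ p q, (p, q) ∈ S → r (p, q) (q, p)) →
      (∀ p q p' : ι, {q' : ι | r (p, q) (p', q')}.ncard ≤ B) →
      (equivCount r : ℝ) ≤ ε * (Fintype.card ι : ℝ) ^ 3 →
      (pathCount r : ℝ) ≤ ε * (Fintype.card ι : ℝ) ^ 2 → ∀ u,
      (listCount (k + 1) (fun l => Exceptional r S l ∧ numClasses r l = u) : ℝ) ≤
        C * ε * (Fintype.card ι : ℝ) ^ (u + 1) := by
  induction k with
  | zero =>
    refine ⟨0, le_rfl, fun ι _ r S ε _ _ _ _ _ _ u => ?_⟩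
    rw [listCount_eq_zero]
    · simp
    · rintro l hl ⟨⟨-, -, h⟩, -⟩
      obtain ⟨p, rfl⟩ := List.length_eq_one_iff.1 hl
      exact h _ (.start p)
  | succ k ih =>
    obtain ⟨C, hC, ih⟩ := ih
    refine ⟨C + k * B * C + 2 ^ k * (k + 1), by positivity,
      fun ι _ r S ε hN hε hswap hB h1 h3 u => ?_⟩
    specialize ih ι r S ε hN hε hswap hB h1 h3
    have hN' : (0 : ℝ) < Fintype.card ι := by exact_mod_cast hN
    -- The length of `t` is forced by `2 * u + 2 = (k + 1) + (t.length + 1)`. The recorded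
    -- inequalities make the truncated subtraction exact and express that the stack is no longer
    -- than the walk.
    have a1 : listCount (k + 2) (fun l => Exceptional r S l ∧ numClasses r l = u) ≤
        (Fintype.card ι * listCount (k + 1) (fun l => Exceptional r S l ∧ numClasses r l + 1 = u) +
        k * B * listCount (k + 1) (fun l => Exceptional r S l ∧ numClasses r l = u)) +
        listCount (k + 2) (fun l => ∃ q p l' t, l = q :: p :: l' ∧
          TreeWalk r S (p :: l') (p :: t) ∧ Stray r t p q ∧ t.length = 2 * u - k ∧
            (k ≤ 2 * u ∧ u ≤ k)) := by
      refine le_trans ?_ (Nat.add_le_add_right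
        (listCount_tail_numClasses_le r hB (Exceptional r S) k u) _)
      refine le_trans (listCount_mono ?_) (listCount_or_le _ _ _)
      rintro l hl ⟨hE, hu⟩
      obtain ⟨q, l, rfl⟩ := List.exists_cons_of_length_eq_add_one hl
      rw [List.length_cons, Nat.add_right_cancel_iff] at hl
      obtain ⟨p, l, rfl⟩ := List.exists_cons_of_length_eq_add_one hl
      rcases hE.step hswap with h | ⟨t, hw, hs, hn⟩
      · exact Or.inl ⟨h, hu⟩
      · refine Or.inr ⟨q, p, l, t, rfl, hw, hs, ?_⟩
        have e1 := hw.two_mul_numClasses hswap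
        have e2 := hw.length_stack_le
        rw [← hn, hu, hl, List.length_cons] at e1
        rw [hl, List.length_cons] at e2
        omega
    have b1 : (Fintype.card ι : ℝ) *
        listCount (k + 1) (fun l => Exceptional r S l ∧ numClasses r l + 1 = u) ≤
        C * ε * (Fintype.card ι : ℝ) ^ (u + 1) := by
      cases u with
      | zero =>
        rw [listCount_eq_zero]
        · simp only [CharP.cast_eq_zero, mul_zero]
          positivity
        · simp
      | succ u =>
        simp only [add_left_inj]
        calc _ ≤ (Fintype.card ι : ℝ) * (C * ε * (Fintype.card ι : ℝ) ^ (u + 1)) :=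
              mul_le_mul_of_nonneg_left (ih u) hN'.le
          _ = _ := by ring
    have b2 : (listCount (k + 2) (fun l => ∃ q p l' t, l = q :: p :: l' ∧
          TreeWalk r S (p :: l') (p :: t) ∧ Stray r t p q ∧ t.length = 2 * u - k ∧
            (k ≤ 2 * u ∧ u ≤ k)) : ℝ) ≤
        2 ^ k * (k + 1) * ε * (Fintype.card ι : ℝ) ^ (u + 1) := by
      by_cases hu : k ≤ 2 * u ∧ u ≤ k
      · obtain ⟨m, hm⟩ := Nat.exists_eq_add_of_le hu.1
        obtain ⟨e, he⟩ := Nat.exists_eq_add_of_le hu.2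
        have hmu : 2 * u - k = m := by omega
        rw [hmu]
        have h5 := sum_stray_le r hN h1 h3 m
        have h6 := listCount_stray_le r S k m (k ≤ 2 * u ∧ u ≤ k)
        have h7 : ∑ p, ∑ t ∈ listsOfLength ι m,
            listCount (k + 1) (fun l => TreeWalk r S l (p :: t)) *
              (Finset.univ.filter fun q => Stray r t p q).card ≤
            2 ^ k * Fintype.card ι ^ e * ∑ p, ∑ t ∈ listsOfLength ι m,
              (Finset.univ.filter fun q => Stray r t p q).card := by
          rw [Finset.mul_sum]
          refine Finset.sum_le_sum fun p _ => ?_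
          rw [Finset.mul_sum]
          refine Finset.sum_le_sum fun t ht => Nat.mul_le_mul_right _ ?_
          apply listCount_treeWalk_stack_le
          rw [List.length_cons, mem_listsOfLength.1 ht]
          omega
        calc _ ≤ ((2 ^ k * Fintype.card ι ^ e * ∑ p, ∑ t ∈ listsOfLength ι m,
              (Finset.univ.filter fun q => Stray r t p q).card : ℕ) : ℝ) := by
              exact_mod_cast h6.trans h7
          _ = 2 ^ k * (Fintype.card ι : ℝ) ^ e * ((∑ p, ∑ t ∈ listsOfLength ι m,
              (Finset.univ.filter fun q => Stray r t p q).card : ℕ) : ℝ) := by push_cast; rfl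
          _ ≤ 2 ^ k * (Fintype.card ι : ℝ) ^ e *
              ((m + 1) * ε * (Fintype.card ι : ℝ) ^ (m + 1)) := by gcongr
          -- From `2 * u = k + m` and `k = u + e` follows `e + m = u`, which is the required
          -- exponent.
          _ = 2 ^ k * (m + 1) * ε * (Fintype.card ι : ℝ) ^ (e + (m + 1)) := by ring
          _ = 2 ^ k * (m + 1) * ε * (Fintype.card ι : ℝ) ^ (u + 1) := by
              congr 2
              omega
          _ ≤ _ := by
              have : (m : ℝ) ≤ k := by exact_mod_cast (by omega : m ≤ k)
              gcongr
      · rw [listCount_eq_zero]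
        · simp only [CharP.cast_eq_zero]
          positivity
        · rintro l - ⟨q, p, l', t, -, -, -, -, h⟩
          exact hu h
    have c1 := ih u
    have c2 : ((listCount (k + 2) (fun l => Exceptional r S l ∧ numClasses r l = u) : ℕ) : ℝ) ≤
        _ := Nat.cast_le.2 a1
    push_cast at c2
    calc _ ≤ _ := c2
      _ ≤ C * ε * (Fintype.card ι : ℝ) ^ (u + 1) + k * B *
            (C * ε * (Fintype.card ι : ℝ) ^ (u + 1)) +
          2 ^ k * (k + 1) * ε * (Fintype.card ι : ℝ) ^ (u + 1) := by gcongr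
      _ = _ := by ring

end ExceptionalWalks

/-! ### Asymptotics of tree walks and the bound for negligible walks -/

section TreeCount

open scoped Classical

variable {ι : Type} (r : Setoid (ι × ι)) (S : Set (ι × ι))

/-- A walk that meets each of its equivalence classes at least twice, and is not a complete tree
walk. -/
def Negligible (l : List ι) : Prop :=
  (∀ e ∈ edges l, e ∈ S) ∧ (∀ e ∈ edges l, 2 ≤ (classList r l).count (Quotient.mk r e)) ∧
    ¬∃ s, s.length = 1 ∧ TreeWalk r S l s

/-- The multiplicities of the classes add up to `k` and each is at least two. So there are fewer
than `k/2` classes, or every multiplicity equals two; in the latter case a tree walk would have a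
stack of length one. -/
theorem Negligible.numClasses {r : Setoid (ι × ι)} {S : Set (ι × ι)}
    (hswap : ∀ p q, (p, q) ∈ S → r (p, q) (q, p)) {l : List ι} {k : ℕ}
    (hl : l.length = k + 1) (h : Negligible r S l) :
    2 * numClasses r l < k ∨ Exceptional r S l ∧ 2 * numClasses r l = k := by
  obtain ⟨h1, h2, h3⟩ := h
  have h4 : ∑ c ∈ (classList r l).toFinset, (classList r l).count c = k := by
    rw [List.sum_toFinset_count_eq_length, classList, List.length_map, length_edges, hl]
    rfl
  have h5 : ∀ c ∈ (classList r l).toFinset, 2 ≤ (classList r l).count c := by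
    intro c hc
    rw [List.mem_toFinset, classList, List.mem_map] at hc
    obtain ⟨e, he, rfl⟩ := hc
    exact h2 e he
  have h6 : ∑ c ∈ (classList r l).toFinset, 2 = 2 * _root_.numClasses r l := by
    rw [Finset.sum_const, smul_eq_mul, mul_comm]
    rfl
  have h7 := Finset.sum_le_sum h5
  rw [h4, h6] at h7
  refine (lt_or_eq_of_le h7).imp id fun h8 => ⟨⟨h1, ?_, ?_⟩, h8⟩
  · intro c
    by_cases hc : c ∈ (classList r l).toFinset
    · exact ((Finset.sum_eq_sum_iff_of_le h5).1 (by rw [h4, h6, h8]) c hc).ge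
    · rw [List.mem_toFinset] at hc
      rw [List.count_eq_zero_of_not_mem hc]
      exact Nat.zero_le _
  · intro s hs
    have := hs.two_mul_numClasses hswap
    exact h3 ⟨s, by omega, hs⟩

variable [Fintype ι]

/-- The number of tree walks with `k` steps and final stack of length `m`. -/
noncomputable def treeCount (k m : ℕ) : ℕ :=
  listCount (k + 1) fun l => ∃ s, s.length = m ∧ TreeWalk r S l s

theorem treeCount_zero_right (k : ℕ) : treeCount r S k 0 = 0 := by
  apply listCount_eq_zero
  rintro l - ⟨s, hs, hw⟩
  obtain ⟨p, l', s', -, rfl⟩ := hw.exists_cons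
  simp at hs

theorem treeCount_zero_left (m : ℕ) :
    treeCount r S 0 m = if m = 1 then Fintype.card ι else 0 := by
  split_ifs with h
  · subst h
    have : listCount (ι := ι) 1 (fun l => ∃ s, s.length = 1 ∧ TreeWalk r S l s) =
        (listsOfLength ι 1).card := by
      rw [listCount, Finset.filter_true_of_mem]
      intro l hl
      obtain ⟨p, rfl⟩ := List.length_eq_one_iff.1 (mem_listsOfLength.1 hl)
      exact ⟨[p], rfl, .start p⟩
    rw [treeCount, this, card_listsOfLength, pow_one]
  · apply listCount_eq_zero
    rintro l hl ⟨s, hs, hw⟩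
    obtain ⟨p, rfl⟩ := List.length_eq_one_iff.1 hl
    cases hw
    exact h hs.symm

variable {r S}

/-- A stack of length `m` can grow through every endpoint except the at most two outside `S` and the
at most `k * B` leading to old classes; a stack of length `m + 2` can shrink in exactly one way. By
uniqueness of the stack the two cases exclude each other. -/
theorem card_extensions {B : ℕ}
    (hswap : ∀ p q, (p, q) ∈ S → r (p, q) (q, p))
    (hB : ∀ p q p' : ι, {q' : ι | r (p, q) (p', q')}.ncard ≤ B)
    (hS : ∀ p, (Finset.univ.filter fun q => (p, q) ∉ S).card ≤ 2) (k m : ℕ) (l : List ι)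
    (hl : l.length = k + 1) :
    (Finset.univ.filter fun q => ∃ s, s.length = m + 1 ∧ TreeWalk r S (q :: l) s).card ≤
      Fintype.card ι * (if ∃ s, s.length = m ∧ TreeWalk r S l s then 1 else 0) +
        (if ∃ s, s.length = m + 2 ∧ TreeWalk r S l s then 1 else 0) ∧
    Fintype.card ι * (if ∃ s, s.length = m ∧ TreeWalk r S l s then 1 else 0) +
        (if ∃ s, s.length = m + 2 ∧ TreeWalk r S l s then 1 else 0) ≤
      (Finset.univ.filter fun q => ∃ s, s.length = m + 1 ∧ TreeWalk r S (q :: l) s).card +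
        (2 + k * B) * (if ∃ s, s.length = m ∧ TreeWalk r S l s then 1 else 0) := by
  obtain ⟨p, l, rfl⟩ := List.exists_cons_of_length_eq_add_one hl
  by_cases ha : ∃ s, s.length = m ∧ TreeWalk r S (p :: l) s
  · have hb : ¬∃ s, s.length = m + 2 ∧ TreeWalk r S (p :: l) s := by
      rintro ⟨s, hs, hw⟩
      obtain ⟨s', hs', hw'⟩ := ha
      rw [hw.stack_unique hswap hw'] at hs
      omega
    rw [if_pos ha, if_neg hb, mul_one, mul_one, add_zero]
    refine ⟨Finset.card_le_univ _, ?_⟩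
    obtain ⟨s, hs, hw⟩ := ha
    obtain ⟨p', l', t, hp, rfl⟩ := hw.exists_cons
    obtain ⟨rfl, rfl⟩ := List.cons.inj hp
    have h1 := card_filter_exists_edge_le r hB p (edges (p :: l))
    rw [length_edges, hl, Nat.add_sub_cancel] at h1
    have h2 := hS p
    have h3 : (Finset.univ : Finset ι) ⊆
        (Finset.univ.filter fun q => ∃ s, s.length = m + 1 ∧ TreeWalk r S (q :: p :: l) s) ∪
        ((Finset.univ.filter fun q => (p, q) ∉ S) ∪
        (Finset.univ.filter fun q => ∃ e ∈ edges (p :: l), r e (p, q))) := by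
      intro q _
      simp only [Finset.mem_union, Finset.mem_filter, Finset.mem_univ, true_and]
      by_cases hq : (p, q) ∈ S
      · by_cases hn : ∃ e ∈ edges (p :: l), r e (p, q)
        · exact Or.inr (Or.inr hn)
        · push Not at hn
          exact Or.inl ⟨q :: p :: t, by rw [List.length_cons, hs], hw.push hq hn⟩
      · exact Or.inr (Or.inl hq)
    calc Fintype.card ι = (Finset.univ : Finset ι).card := rfl
      _ ≤ _ := Finset.card_le_card h3
      _ ≤ _ := Finset.card_union_le _ _
      _ ≤ _ := Nat.add_le_add_left ((Finset.card_union_le _ _).trans (add_le_add h2 h1)) _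
  · rw [if_neg ha, mul_zero, mul_zero, zero_add, add_zero, ← le_antisymm_iff]
    have hc : ∀ q, (∃ s, s.length = m + 1 ∧ TreeWalk r S (q :: p :: l) s) ↔
        ∃ s, s.length = m ∧ TreeWalk r S (p :: l) (p :: q :: s) := by
      intro q
      constructor
      · rintro ⟨s, hs, hw⟩
        cases hw with
        | push hw _ _ =>
          exact absurd ⟨_, by simpa using hs, hw⟩ ha
        | pop hw => exact ⟨_, by simpa using hs, hw⟩
      · rintro ⟨s, hs, hw⟩
        exact ⟨q :: s, by rw [List.length_cons, hs], hw.pop⟩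
    by_cases hb : ∃ s, s.length = m + 2 ∧ TreeWalk r S (p :: l) s
    · rw [if_pos hb, Finset.card_eq_one]
      obtain ⟨s, hs, hw⟩ := hb
      obtain ⟨p', l', t, hp, rfl⟩ := hw.exists_cons
      obtain ⟨rfl, rfl⟩ := List.cons.inj hp
      obtain ⟨q, t, rfl⟩ := List.exists_cons_of_length_eq_add_one (Nat.succ.inj hs)
      refine ⟨q, ?_⟩
      ext q'
      simp only [Finset.mem_filter, Finset.mem_univ, true_and, Finset.mem_singleton]
      rw [hc]
      constructor
      · rintro ⟨s, -, hw'⟩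
        have := hw'.stack_unique hswap hw
        simp only [List.cons.injEq, true_and] at this
        exact this.1
      · rintro rfl
        exact ⟨t, by simpa using hs, hw⟩
    · rw [if_neg hb, Finset.card_eq_zero, Finset.filter_eq_empty_iff]
      intro q _
      rw [hc]
      rintro ⟨s, hs, hw⟩
      exact hb ⟨_, by simp [hs], hw⟩

theorem treeCount_succ_bounds {B : ℕ}
    (hswap : ∀ p q, (p, q) ∈ S → r (p, q) (q, p))
    (hB : ∀ p q p' : ι, {q' : ι | r (p, q) (p', q')}.ncard ≤ B)
    (hS : ∀ p, (Finset.univ.filter fun q => (p, q) ∉ S).card ≤ 2) (k m : ℕ) :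
    treeCount r S (k + 1) (m + 1) ≤
      Fintype.card ι * treeCount r S k m + treeCount r S k (m + 2) ∧
    Fintype.card ι * treeCount r S k m + treeCount r S k (m + 2) ≤
      treeCount r S (k + 1) (m + 1) + (2 + k * B) * treeCount r S k m := by
  simp only [treeCount]
  rw [listCount_succ, listCount_eq_sum, listCount_eq_sum, Finset.mul_sum, Finset.mul_sum,
    ← Finset.sum_add_distrib, ← Finset.sum_add_distrib]
  exact ⟨Finset.sum_le_sum fun l hl =>
      (card_extensions hswap hB hS k m l (mem_listsOfLength.1 hl)).1,
    Finset.sum_le_sum fun l hl =>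
      (card_extensions hswap hB hS k m l (mem_listsOfLength.1 hl)).2⟩

/-- The number of paths from `0` to `m` with `k` steps `±1` on the positive integers, shifted by
one: paths from `1` to `m` that avoid `0`. -/
def ballot : ℕ → ℕ → ℕ
  | 0, m => if m = 1 then 1 else 0
  | _ + 1, 0 => 0
  | k + 1, m + 1 => ballot k m + ballot k (m + 2)

/-- A walk with `k` steps and stack length `m` has `(k + m - 1) / 2` pushes and a free starting
vertex, whence the normalization. Under it, `treeCount_succ_bounds` becomes the recurrence of
`ballot` up to an error of order `1/N`. -/
theorem tendsto_treeCount {ι : ℕ → Type} [∀ n, Fintype (ι n)] (r : ∀ n, Setoid (ι n × ι n))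
    (S : ∀ n, Set (ι n × ι n)) {B : ℕ}
    (hcard : Tendsto (fun n => Fintype.card (ι n)) atTop atTop)
    (hswap : ∀ n p q, (p, q) ∈ S n → r n (p, q) (q, p))
    (hB : ∀ n, ∀ p q p' : ι n, {q' : ι n | r n (p, q) (p', q')}.ncard ≤ B)
    (hS : ∀ n p, (Finset.univ.filter fun q => (p, q) ∉ S n).card ≤ 2) (k m : ℕ) :
    Tendsto (fun n => (treeCount (r n) (S n) k m : ℝ) / √(Fintype.card (ι n)) ^ (k + m + 1))
      atTop (𝓝 (ballot k m)) := by
  have hcard' : Tendsto (fun n => (Fintype.card (ι n) : ℝ)) atTop atTop :=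
    tendsto_natCast_atTop_atTop.comp hcard
  have hpos : ∀ᶠ n in atTop, (0 : ℝ) < Fintype.card (ι n) := hcard'.eventually_gt_atTop 0
  induction k generalizing m with
  | zero =>
    refine (tendsto_congr' ?_).2 tendsto_const_nhds
    filter_upwards [hpos] with n hn
    rw [treeCount_zero_left, ballot]
    split_ifs with h
    · subst h
      rw [Nat.zero_add, Real.sq_sqrt hn.le, div_self hn.ne', Nat.cast_one]
    · simp
  | succ k ih =>
    cases m with
    | zero => simp [treeCount_zero_right, ballot]
    | succ m =>
      have hinv : Tendsto (fun n => (2 + k * B : ℝ) / (Fintype.card (ι n) : ℝ)) atTop (𝓝 0) :=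
        hcard'.const_div_atTop _
      have hup := (ih m).add (ih (m + 2))
      have hlow := hup.sub (hinv.mul (ih m))
      rw [zero_mul, sub_zero] at hlow
      rw [ballot, Nat.cast_add]
      refine tendsto_of_tendsto_of_tendsto_of_le_of_le' hlow hup ?_ ?_
      all_goals
        filter_upwards [hpos] with n hn
        obtain ⟨h1, h2⟩ := treeCount_succ_bounds (hswap n) (hB n) (hS n) k m
        have hx : 0 < √(Fintype.card (ι n) : ℝ) := Real.sqrt_pos.2 hn
        have hx2 : (Fintype.card (ι n) : ℝ) = √(Fintype.card (ι n) : ℝ) ^ 2 :=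
          (Real.sq_sqrt hn.le).symm
        have h1' := (Nat.cast_le (α := ℝ)).2 h1
        have h2' := (Nat.cast_le (α := ℝ)).2 h2
        push_cast at h1' h2'
        generalize √(Fintype.card (ι n) : ℝ) = x at *
        rw [hx2] at h1' h2' 
        have e1 : (treeCount (r n) (S n) k m : ℝ) / x ^ (k + m + 1) =
          x ^ 2 * treeCount (r n) (S n) k m / x ^ (k + 1 + (m + 1) + 1) := by
          rw [div_eq_div_iff (by positivity) (by positivity)]
          ring
      · have e2 : (2 + k * B : ℝ) / (Fintype.card (ι n) : ℝ) *
            ((treeCount (r n) (S n) k m : ℝ) / x ^ (k + m + 1)) =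
            (2 + k * B) * treeCount (r n) (S n) k m / x ^ (k + 1 + (m + 1) + 1) := by
          rw [hx2, div_mul_div_comm, div_eq_div_iff (by positivity) (by positivity)]
          ring
        rw [e2, e1, show k + (m + 2) + 1 = k + 1 + (m + 1) + 1 by ring, ← add_div, ← sub_div]
        gcongr
        linarith
      · rw [e1, show k + (m + 2) + 1 = k + 1 + (m + 1) + 1 by ring, ← add_div]
        gcongr

/-- If `2 * u < k`, then `N ^ (u + 1)` is at most `√N ^ (k + 1)`; the exceptional walks with `2 * u
= k` account for the term with `ε`. Both are small compared with `√N ^ (k + 2)`, uniformly once `ε`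
tends to zero. -/
theorem listCount_negligible_le (B k : ℕ) : ∃ C : ℝ, 0 ≤ C ∧
    ∀ (ι : Type) [Fintype ι] (r : Setoid (ι × ι)) (S : Set (ι × ι)) (ε : ℝ),
      0 < Fintype.card ι → 0 ≤ ε → (∀ p q, (p, q) ∈ S → r (p, q) (q, p)) →
      (∀ p q p' : ι, {q' : ι | r (p, q) (p', q')}.ncard ≤ B) →
      (equivCount r : ℝ) ≤ ε * (Fintype.card ι : ℝ) ^ 3 →
      (pathCount r : ℝ) ≤ ε * (Fintype.card ι : ℝ) ^ 2 →
      (listCount (k + 1) (Negligible r S) : ℝ) ≤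
        C * (√(Fintype.card ι) ^ (k + 1) + ε * √(Fintype.card ι) ^ (k + 2)) := by
  obtain ⟨C, hC, hE⟩ := listCount_exceptional_le B k
  refine ⟨k * (1 + k * B) ^ k + C, by positivity, fun ι _ r S ε hN hε hswap hB h1 h3 => ?_⟩
  specialize hE ι r S ε hN hε hswap hB h1 h3
  have a1 : listCount (k + 1) (Negligible r S) ≤
      listCount (k + 1) (fun l : List ι => 2 * numClasses r l < k) +
        listCount (k + 1) (fun l => Exceptional r S l ∧ 2 * numClasses r l = k) :=
    (listCount_mono fun l hl h => h.numClasses hswap hl).trans (listCount_or_le _ _ _)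
  have hN1 : (1 : ℝ) ≤ Fintype.card ι := by exact_mod_cast hN
  have hx1 : 1 ≤ √(Fintype.card ι : ℝ) := Real.one_le_sqrt.2 hN1
  have hx2 : (Fintype.card ι : ℝ) = √(Fintype.card ι : ℝ) ^ 2 :=
    (Real.sq_sqrt (by positivity)).symm
  have b1 : (listCount (k + 1) (fun l : List ι => 2 * numClasses r l < k) : ℝ) ≤
      k * (1 + k * B) ^ k * √(Fintype.card ι) ^ (k + 1) := by
    have c1 : listCount (k + 1) (fun l : List ι => 2 * numClasses r l < k) ≤
        ∑ u ∈ (Finset.range k).filter (fun u => 2 * u < k),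
          listCount (k + 1) (fun l : List ι => numClasses r l = u) := by
      refine le_trans (Finset.card_le_card fun l hl => ?_) Finset.card_biUnion_le
      simp only [Finset.mem_filter] at hl
      rw [Finset.mem_biUnion]
      refine ⟨numClasses r l, ?_, by simpa using hl.1⟩
      rw [Finset.mem_filter, Finset.mem_range]
      omega
    calc _ ≤ ((∑ u ∈ (Finset.range k).filter (fun u => 2 * u < k),
          listCount (k + 1) (fun l : List ι => numClasses r l = u) : ℕ) : ℝ) := Nat.cast_le.2 c1
      _ ≤ ∑ u ∈ (Finset.range k).filter (fun u => 2 * u < k),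
          (1 + k * B : ℝ) ^ k * √(Fintype.card ι) ^ (k + 1) := by
          rw [Nat.cast_sum]
          refine Finset.sum_le_sum fun u hu => ?_
          rw [Finset.mem_filter] at hu
          have c2 := (Nat.cast_le (α := ℝ)).2 (listCount_numClasses_le r hB k u)
          push_cast at c2
          refine c2.trans ?_
          rw [hx2, ← pow_mul, Real.sqrt_sq (by positivity)]
          gcongr
          omega
      _ ≤ k * ((1 + k * B : ℝ) ^ k * √(Fintype.card ι) ^ (k + 1)) := by
          rw [Finset.sum_const, nsmul_eq_mul]
          gcongr
          simpa using Finset.card_filter_le (Finset.range k) (fun u => 2 * u < k)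
      _ = _ := by ring
  have b2 : (listCount (k + 1) (fun l => Exceptional r S l ∧ 2 * numClasses r l = k) : ℝ) ≤
      C * (ε * √(Fintype.card ι) ^ (k + 2)) := by
    by_cases hk : ∃ u, 2 * u = k
    · obtain ⟨u, rfl⟩ := hk
      have := hE u
      rw [hx2, ← pow_mul] at this
      refine le_trans (le_of_eq ?_) (this.trans (le_of_eq (by ring)))
      congr 2
      ext l
      simp
    · rw [listCount_eq_zero]
      · simp only [CharP.cast_eq_zero]
        positivity
      · rintro l - ⟨-, h⟩
        exact hk ⟨_, h⟩
  have hk : (0 : ℝ) ≤ k * (1 + k * B) ^ k := by positivity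
  have hp : 0 ≤ √(Fintype.card ι : ℝ) ^ (k + 1) := by positivity
  have hq : 0 ≤ ε * √(Fintype.card ι : ℝ) ^ (k + 2) := by positivity
  calc _ ≤ _ := Nat.cast_le.2 a1
    _ ≤ k * (1 + k * B) ^ k * √(Fintype.card ι) ^ (k + 1) +
        C * (ε * √(Fintype.card ι) ^ (k + 2)) := by
        push_cast
        exact add_le_add b1 b2
    _ ≤ _ := by nlinarith [mul_nonneg hk hq, mul_nonneg hC hp]

end TreeCount

/-! ### Traces of powers as sums over closed walks -/

section TraceFormula

variable {ι : Type} [Fintype ι] [DecidableEq ι]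

theorem pow_apply_eq_sum_walks (A : Matrix ι ι ℂ) (k : ℕ) (p q : ι) :
    (A ^ k) p q = ∑ l ∈ listsOfLength ι (k + 1),
      if l.head? = some q ∧ l.getLast? = some p then
        ((edges l).map fun e => A e.1 e.2).prod else 0 := by
  induction k generalizing q with
  | zero =>
    rw [pow_zero, sum_listsOfLength_succ]
    simp only [listsOfLength, Finset.sum_singleton, List.head?_cons, List.getLast?_singleton,
      Option.some.injEq, edges_singleton, List.map_nil, List.prod_nil, Matrix.one_apply]
    by_cases h : p = q
    · subst h
      simp
    · rw [if_neg h, Finset.sum_eq_zero]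
      intro x _
      rw [if_neg]
      rintro ⟨rfl, rfl⟩
      exact h rfl
  | succ k ih =>
    rw [pow_succ, Matrix.mul_apply, sum_listsOfLength_succ]
    simp only [ih, Finset.sum_mul]
    rw [Finset.sum_comm]
    refine Finset.sum_congr rfl fun l hl => ?_
    obtain ⟨y, l, rfl⟩ := List.exists_cons_of_length_eq_add_one (mem_listsOfLength.1 hl)
    simp only [List.head?_cons, Option.some.injEq, List.getLast?_cons_cons, edges_cons_cons,
      List.map_cons, List.prod_cons]
    rw [Finset.sum_eq_single y, Finset.sum_eq_single q]
    · by_cases h : (y :: l).getLast? = some p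
      · simp [h, mul_comm]
      · simp [h]
    · intro x _ hx
      rw [if_neg (fun h => hx h.1)]
    · simp
    · intro x _ hx
      rw [if_neg (fun h => hx h.1.symm), zero_mul]
    · simp

theorem trace_pow_eq_sum_walks (A : Matrix ι ι ℂ) (k : ℕ) :
    (A ^ k).trace = ∑ l ∈ listsOfLength ι (k + 1),
      if l.head? = l.getLast? then ((edges l).map fun e => A e.1 e.2).prod else 0 := by
  simp only [Matrix.trace, Matrix.diag_apply, pow_apply_eq_sum_walks]
  rw [Finset.sum_comm]
  refine Finset.sum_congr rfl fun l hl => ?_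
  obtain ⟨y, l, rfl⟩ := List.exists_cons_of_length_eq_add_one (mem_listsOfLength.1 hl)
  rw [Finset.sum_eq_single y]
  · simp [eq_comm]
  · intro x _ hx
    rw [if_neg]
    rintro ⟨h, -⟩
    simp only [List.head?_cons, Option.some.injEq] at h
    exact hx h.symm
  · simp

end TraceFormula

/-! ### Expectations of products along walks -/

section Expectation

open scoped Classical

variable {ι : Type} {Ω : Type*} [MeasurableSpace Ω] {P : Measure Ω}
  {a : ι → ι → Ω → ℂ} {r : Setoid (ι × ι)} {S : Set (ι × ι)}

theorem measurable_prod_entries (hmeas : ∀ p q, Measurable (a p q)) (L : List (ι × ι)) :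
    Measurable fun ω => (L.map fun e => a e.1 e.2 ω).prod := by
  induction L with
  | nil => simp
  | cons e L ih =>
    simp only [List.map_cons, List.prod_cons]
    exact (hmeas _ _).mul ih

/-- Independence is only assumed between one entry and the family of entries not equivalent to it,
so factors are split off one entry at a time. The function `φ` allows splitting off `|a(p,q)|^2` in
one step. -/
theorem integral_mul_prod_entries (hmeas : ∀ p q, Measurable (a p q))
    (hindep : ∀ p q, IndepFun (a p q)
      (fun ω (t : {t : ι × ι // ¬r (p, q) t}) => a t.1.1 t.1.2 ω) P)
    {φ : ℂ → ℂ} (hφ : Measurable φ) {p q : ι} {L : List (ι × ι)}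
    (hL : ∀ e ∈ L, ¬r (p, q) e) :
    ∫ ω, φ (a p q ω) * (L.map fun e => a e.1 e.2 ω).prod ∂P =
      (∫ ω, φ (a p q ω) ∂P) * ∫ ω, (L.map fun e => a e.1 e.2 ω).prod ∂P := by
  obtain ⟨ψ, hψ, hψe⟩ : ∃ ψ : ({t : ι × ι // ¬r (p, q) t} → ℂ) → ℂ, Measurable ψ ∧
      ∀ ω, ψ (fun t => a t.1.1 t.1.2 ω) = (L.map fun e => a e.1 e.2 ω).prod := by
    induction L with
    | nil => exact ⟨fun _ => 1, measurable_const, by simp⟩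
    | cons e L ih =>
      obtain ⟨ψ, hψ, hψe⟩ := ih fun e' he' => hL e' (List.mem_cons_of_mem _ he')
      refine ⟨fun g => g ⟨e, hL e List.mem_cons_self⟩ * ψ g, (measurable_pi_apply _).mul hψ,
        fun ω => ?_⟩
      simp only [hψe, List.map_cons, List.prod_cons]
  have h := (hindep p q).comp hφ hψ
  have h1 : AEStronglyMeasurable (φ ∘ a p q) P :=
    (hφ.comp (hmeas p q)).aestronglyMeasurable
  have h2 : (ψ ∘ fun ω (t : {t : ι × ι // ¬r (p, q) t}) => a t.1.1 t.1.2 ω) =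
      fun ω => (L.map fun e => a e.1 e.2 ω).prod := funext hψe
  rw [h2] at h
  exact h.integral_fun_mul_eq_mul_integral h1
    (measurable_prod_entries hmeas L).aestronglyMeasurable

theorem integral_prod_entries_of_isolated (hmeas : ∀ p q, Measurable (a p q))
    (hindep : ∀ p q, IndepFun (a p q)
      (fun ω (t : {t : ι × ι // ¬r (p, q) t}) => a t.1.1 t.1.2 ω) P)
    (hcent : ∀ p q, ∫ ω, a p q ω ∂P = 0) {l : List ι} {e : ι × ι} (he : e ∈ edges l)
    (hc : (classList r l).count (Quotient.mk r e) < 2) :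
    ∫ ω, ((edges l).map fun e => a e.1 e.2 ω).prod ∂P = 0 := by
  obtain ⟨L₁, L₂, hL⟩ := List.append_of_mem he
  rw [classList, hL, List.map_append, List.map_cons, List.count_append, List.count_cons_self] at hc
  have h0 : ∀ e' ∈ L₁ ++ L₂, ¬r e e' := by
    intro e' he' hr
    rw [List.mem_append] at he'
    rw [Quotient.sound hr] at hc
    rcases he' with he' | he'
    · have := List.one_le_count_iff.2 (List.mem_map_of_mem (f := Quotient.mk r) he')
      omega
    · have := List.one_le_count_iff.2 (List.mem_map_of_mem (f := Quotient.mk r) he')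
      omega
  have h1 : ∀ ω, ((edges l).map fun e => a e.1 e.2 ω).prod =
      id (a e.1 e.2 ω) * ((L₁ ++ L₂).map fun e => a e.1 e.2 ω).prod := by
    intro ω
    simp only [hL, List.map_append, List.map_cons, List.prod_append, List.prod_cons, id]
    exact mul_left_comm _ _ _
  simp only [h1]
  rw [integral_mul_prod_entries hmeas hindep measurable_id h0]
  simp only [id, hcent, zero_mul]

/-- By hermiticity each pair of opposite entries is a function of a single entry, namely its squared
modulus, and the remaining pairs are not equivalent to it. Hence the factors `1` split off
successively. -/
theorem integral_prod_pairs [IsProbabilityMeasure P] (hmeas : ∀ p q, Measurable (a p q))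
    (hindep : ∀ p q, IndepFun (a p q)
      (fun ω (t : {t : ι × ι // ¬r (p, q) t}) => a t.1.1 t.1.2 ω) P)
    (hstar : ∀ p q ω, a q p ω = starRingEnd ℂ (a p q ω))
    (hvar : ∀ p q, (p, q) ∈ S → ∫ ω, a p q ω * starRingEnd ℂ (a p q ω) ∂P = 1)
    (hswap : ∀ p q, (p, q) ∈ S → r (p, q) (q, p))
    {F : List (ι × ι)} (hF : ∀ e ∈ F, e ∈ S) (hp : F.Pairwise fun e e' => ¬r e e') :
    ∫ ω, (F.map fun e => a e.1 e.2 ω * a e.swap.1 e.swap.2 ω).prod ∂P = 1 := by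
  induction F with
  | nil => simp
  | cons e F ih =>
    rw [List.pairwise_cons] at hp
    have h0 : ∀ e' ∈ F.flatMap (fun e => [e, e.swap]), ¬r e e' := by
      intro e' he' hr
      simp only [List.mem_flatMap, List.mem_cons, List.not_mem_nil, or_false] at he'
      obtain ⟨e'', he'', rfl | rfl⟩ := he'
      · exact hp.1 _ he'' hr
      · exact hp.1 _ he'' (r.trans hr (r.symm (hswap _ _ (hF _ (List.mem_cons_of_mem _ he'')))))
    have h1 : ∀ ω, (F.map fun e => a e.1 e.2 ω * a e.swap.1 e.swap.2 ω).prod =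
        ((F.flatMap fun e => [e, e.swap]).map fun e => a e.1 e.2 ω).prod := by
      intro ω
      clear ih hp h0 hF
      induction F with
      | nil => simp
      | cons e F ih =>
        simp only [List.map_cons, List.prod_cons, List.flatMap_cons, List.map_append,
          List.prod_append, ih, List.map_nil, List.prod_nil, mul_one]
    have h2 := ih (fun e he => hF e (List.mem_cons_of_mem _ he)) hp.2
    simp only [h1] at h2
    simp only [List.map_cons, List.prod_cons, h1]
    simp only [Prod.fst_swap, Prod.snd_swap, hstar e.1 e.2]
    rw [integral_mul_prod_entries (φ := fun z => z * starRingEnd ℂ z) hmeas hindep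
      (measurable_id.mul (Complex.continuous_conj.measurable)) h0, h2,
      hvar _ _ (hF _ List.mem_cons_self), one_mul]

/-- Otherwise `a(p,q)` would be independent of its own conjugate `a(q,p)`, and its second moment
would be a product of two vanishing means instead of `1`. -/
theorem equiv_swap (hmeas : ∀ p q, Measurable (a p q))
    (hindep : ∀ p q, IndepFun (a p q)
      (fun ω (t : {t : ι × ι // ¬r (p, q) t}) => a t.1.1 t.1.2 ω) P)
    (hstar : ∀ p q ω, a q p ω = starRingEnd ℂ (a p q ω))
    (hvar : ∀ p q, (p, q) ∈ S → ∫ ω, a p q ω * starRingEnd ℂ (a p q ω) ∂P = 1)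
    (hcent : ∀ p q, ∫ ω, a p q ω ∂P = 0) (p q : ι) (h : (p, q) ∈ S) : r (p, q) (q, p) := by
  by_contra hn
  have h1 := integral_mul_prod_entries (φ := id) (L := [(q, p)]) hmeas hindep measurable_id
    (p := p) (q := q) (by simpa using hn)
  simp only [List.map_cons, List.map_nil, List.prod_cons, List.prod_nil, mul_one, id,
    hstar p q, hvar p q h, hcent, zero_mul] at h1
  exact one_ne_zero h1

/-- The product is bounded by the power of its largest factor. This crude bound replaces Hölder's
inequality. -/
theorem prod_le_sum_pow (L : List ℝ≥0∞) (hL : L ≠ []) :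
    L.prod ≤ (L.map fun x => x ^ L.length).sum := by
  obtain ⟨x, hx, hmax⟩ : ∃ x ∈ L, ∀ y ∈ L, y ≤ x := by
    obtain ⟨x, hx, h⟩ := L.toFinset.exists_max_image id
      (by simpa [List.toFinset_nonempty_iff] using hL)
    exact ⟨x, by simpa using hx, fun y hy => h y (by simpa using hy)⟩
  calc L.prod ≤ x ^ L.length := List.prod_le_pow_card L x hmax
    _ ≤ _ := List.single_le_sum (by simp) _ (List.mem_map_of_mem (f := fun x => x ^ L.length) hx)

theorem lintegral_prod_entries_le [IsProbabilityMeasure P] (hmeas : ∀ p q, Measurable (a p q))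
    {k : ℕ} {K : ℝ≥0} (hK : ∀ p q, ∫⁻ ω, ‖a p q ω‖ₑ ^ k ∂P ≤ K) (L : List (ι × ι))
    (hL : L.length = k) :
    ∫⁻ ω, ‖(L.map fun e => a e.1 e.2 ω).prod‖ₑ ∂P ≤ (1 + k * K : ℝ≥0) := by
  have hn : ∀ ω, ‖(L.map fun e => a e.1 e.2 ω).prod‖ₑ = (L.map fun e => ‖a e.1 e.2 ω‖ₑ).prod := by
    intro ω
    clear hL
    induction L with
    | nil => simp
    | cons e L ih => simp [enorm_mul, ih]
  simp only [hn]
  -- The empty product has integral `1`; this is the reason for the summand `1` in the bound.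
  by_cases h0 : L = []
  · subst h0
    simp
  · have h1 : ∀ ω, (L.map fun e => ‖a e.1 e.2 ω‖ₑ).prod ≤
        (L.map fun e => ‖a e.1 e.2 ω‖ₑ ^ k).sum := by
      intro ω
      have := prod_le_sum_pow (L.map fun e => ‖a e.1 e.2 ω‖ₑ) (by simpa using h0)
      rwa [List.map_map, List.length_map, hL] at this
    have h2 : ∀ L : List (ι × ι), ∫⁻ ω, (L.map fun e => ‖a e.1 e.2 ω‖ₑ ^ k).sum ∂P ≤
        L.length * K := by
      intro L
      induction L with
      | nil => simp
      | cons e L ih =>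
        simp only [List.map_cons, List.sum_cons, List.length_cons]
        rw [lintegral_add_left ((hmeas _ _).enorm.pow_const k)]
        push_cast
        rw [add_mul, one_mul, add_comm]
        exact add_le_add ih (hK _ _)
    calc _ ≤ _ := lintegral_mono h1
      _ ≤ _ := h2 L
      _ ≤ _ := by
        rw [hL]
        push_cast
        exact le_add_self

theorem integrable_prod_entries [IsProbabilityMeasure P] (hmeas : ∀ p q, Measurable (a p q))
    (hmom : ∀ k : ℕ, ∃ K : ℝ≥0, ∀ p q, ∫⁻ ω, ‖a p q ω‖ₑ ^ k ∂P ≤ K) (L : List (ι × ι)) :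
    Integrable (fun ω => (L.map fun e => a e.1 e.2 ω).prod) P := by
  obtain ⟨K, hK⟩ := hmom L.length
  exact ⟨(measurable_prod_entries hmeas L).aestronglyMeasurable,
    (lintegral_prod_entries_le hmeas hK L rfl).trans_lt ENNReal.coe_lt_top⟩

theorem integral_prod_treeWalk [IsProbabilityMeasure P] (hmeas : ∀ p q, Measurable (a p q))
    (hindep : ∀ p q, IndepFun (a p q)
      (fun ω (t : {t : ι × ι // ¬r (p, q) t}) => a t.1.1 t.1.2 ω) P)
    (hstar : ∀ p q ω, a q p ω = starRingEnd ℂ (a p q ω))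
    (hvar : ∀ p q, (p, q) ∈ S → ∫ ω, a p q ω * starRingEnd ℂ (a p q ω) ∂P = 1)
    (hswap : ∀ p q, (p, q) ∈ S → r (p, q) (q, p)) {l s : List ι} (hw : TreeWalk r S l s)
    (hs : s.length = 1) : ∫ ω, ((edges l).map fun e => a e.1 e.2 ω).prod ∂P = 1 := by
  obtain ⟨F, h1, h2, h3⟩ := hw.exists_prod_eq
  obtain ⟨p, rfl⟩ := List.length_eq_one_iff.1 hs
  simp only [edges_singleton, List.append_nil, List.map_nil, List.prod_nil, mul_one] at h1 h2 h3
  simp only [h3]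
  exact integral_prod_pairs hmeas hindep hstar hvar hswap (fun e he => (h1 e he).1) h2

/-- The comparison is made walk by walk. Complete tree walks are closed and contribute `1`; walks
that leave `S` or meet some class only once contribute `0`; all others are negligible and are
bounded by the moment of order `k`. -/
theorem norm_integral_trace_sub_treeCount_le [Fintype ι] [IsProbabilityMeasure P]
    (hmeas : ∀ p q, Measurable (a p q))
    (hindep : ∀ p q, IndepFun (a p q)
      (fun ω (t : {t : ι × ι // ¬r (p, q) t}) => a t.1.1 t.1.2 ω) P)
    (hstar : ∀ p q ω, a q p ω = starRingEnd ℂ (a p q ω))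
    (hvar : ∀ p q, (p, q) ∈ S → ∫ ω, a p q ω * starRingEnd ℂ (a p q ω) ∂P = 1)
    (hcent : ∀ p q, ∫ ω, a p q ω ∂P = 0) (hzero : ∀ p q, (p, q) ∉ S → ∀ ω, a p q ω = 0)
    (hmom : ∀ k : ℕ, ∃ K : ℝ≥0, ∀ p q, ∫⁻ ω, ‖a p q ω‖ₑ ^ k ∂P ≤ K)
    {k : ℕ} {K : ℝ≥0} (hK : ∀ p q, ∫⁻ ω, ‖a p q ω‖ₑ ^ k ∂P ≤ K) :
    ‖∫ ω, ((Matrix.of fun p q => a p q ω) ^ k).trace ∂P - treeCount r S k 1‖ ≤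
      (1 + k * K) * listCount (k + 1) (Negligible r S) := by
  have hswap := equiv_swap hmeas hindep hstar hvar hcent
  simp only [trace_pow_eq_sum_walks, Matrix.of_apply]
  have hint : ∀ l : List ι, Integrable (fun ω => if l.head? = l.getLast? then
      ((edges l).map fun e => a e.1 e.2 ω).prod else 0) P := by
    intro l
    split_ifs
    · exact integrable_prod_entries hmeas hmom _
    · exact integrable_zero _ _ _
  rw [integral_finsetSum _ fun l _ => hint l, treeCount, listCount_eq_sum, listCount_eq_sum]
  push_cast
  rw [← Finset.sum_sub_distrib, Finset.mul_sum]
  refine norm_sum_le_of_le _ fun l hl => ?_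
  rw [mem_listsOfLength] at hl
  by_cases hw : ∃ s, s.length = 1 ∧ TreeWalk r S l s
  · rw [if_pos hw]
    obtain ⟨s, hs, hw⟩ := hw
    have hc : l.head? = l.getLast? := by
      rw [hw.getLast_eq]
      obtain ⟨p, l', s', rfl, rfl⟩ := hw.exists_cons
      have : s' = [] := by simpa using hs
      simp [this]
    simp only [if_pos hc]
    rw [integral_prod_treeWalk hmeas hindep hstar hvar hswap hw hs, sub_self, norm_zero]
    positivity
  · rw [if_neg hw, sub_zero]
    by_cases hc : l.head? = l.getLast?
    · simp only [if_pos hc]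
      by_cases hn : Negligible r S l
      · rw [if_pos hn, mul_one]
        have h1 := lintegral_prod_entries_le hmeas hK (edges l) (by rw [length_edges, hl]; rfl)
        have h2 := (enorm_integral_le_lintegral_enorm _).trans h1
        rw [enorm_le_coe, ← NNReal.coe_le_coe] at h2
        simpa using h2
      · have : ∫ ω, ((edges l).map fun e => a e.1 e.2 ω).prod ∂P = 0 := by
          by_cases hS : ∀ e ∈ edges l, e ∈ S
          · have : ∃ e ∈ edges l, (classList r l).count (Quotient.mk r e) < 2 := by
              by_contra h
              push Not at h
              exact hn ⟨hS, h, hw⟩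
            obtain ⟨e, he, h⟩ := this
            exact integral_prod_entries_of_isolated hmeas hindep hcent he h
          · push Not at hS
            obtain ⟨e, he, h⟩ := hS
            have : ∀ ω, ((edges l).map fun e => a e.1 e.2 ω).prod = 0 := fun ω =>
              List.prod_eq_zero (List.mem_map.2 ⟨e, he, hzero _ _ h ω⟩)
            simp [this]
        rw [this, norm_zero]
        positivity
    · simp only [if_neg hc, integral_zero, norm_zero]
      positivity

end Expectation

/-! ### The moments of the semicircle law -/

section Semicircle

theorem integral_cos_int_mul {c : ℤ} (hc : c ≠ 0) :
    ∫ θ in (0 : ℝ)..Real.pi, Real.cos (c * θ) = 0 := by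
  have hc' : (c : ℝ) ≠ 0 := by exact_mod_cast hc
  rw [intervalIntegral.integral_comp_mul_left (fun x => Real.cos x) hc', integral_cos]
  simp [Real.sin_int_mul_pi]

/-- The identity `2 cos θ sin((m+1)θ) = sin(mθ) + sin((m+2)θ)` gives the recurrence of `ballot`, and
orthogonality of the sines gives its initial values. -/
theorem integral_two_cos_pow_mul_sin_mul_sin (k m : ℕ) :
    2 / Real.pi * ∫ θ in (0 : ℝ)..Real.pi,
      (2 * Real.cos θ) ^ k * (Real.sin (m * θ) * Real.sin θ) = ballot k m := by
  induction k generalizing m with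
  | zero =>
    rw [ballot]
    split_ifs with h
    · subst h
      simp only [pow_zero, one_mul, Nat.cast_one, ← sq]
      rw [integral_sin_sq]
      have := Real.pi_ne_zero
      simp only [Real.sin_zero, Real.sin_pi, zero_mul, sub_zero, zero_add]
      field_simp
    · have h1 : ((m : ℤ) - 1) ≠ 0 := by omega
      have h2 : ((m : ℤ) + 1) ≠ 0 := by omega
      have h3 : ∀ θ : ℝ, (2 * Real.cos θ) ^ 0 * (Real.sin (m * θ) * Real.sin θ) =
          2⁻¹ * (Real.cos (((m : ℤ) - 1 : ℤ) * θ) - Real.cos (((m : ℤ) + 1 : ℤ) * θ)) := by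
        intro θ
        push_cast
        rw [sub_mul, add_mul, one_mul, Real.cos_sub, Real.cos_add]
        ring
      simp only [h3]
      rw [intervalIntegral.integral_const_mul, intervalIntegral.integral_sub,
        integral_cos_int_mul h1, integral_cos_int_mul h2]
      · simp
      · exact (by fun_prop : Continuous _).intervalIntegrable _ _
      · exact (by fun_prop : Continuous _).intervalIntegrable _ _
  | succ k ih =>
    cases m with
    | zero => simp [ballot]
    | succ m =>
      have h3 : ∀ θ : ℝ, (2 * Real.cos θ) ^ (k + 1) * (Real.sin ((m + 1 : ℕ) * θ) * Real.sin θ) =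
          (2 * Real.cos θ) ^ k * (Real.sin (m * θ) * Real.sin θ) +
          (2 * Real.cos θ) ^ k * (Real.sin ((m + 2 : ℕ) * θ) * Real.sin θ) := by
        intro θ
        have e1 : (m : ℝ) * θ = (m + 1 : ℕ) * θ - θ := by push_cast; ring
        have e2 : ((m + 2 : ℕ) : ℝ) * θ = (m + 1 : ℕ) * θ + θ := by push_cast; ring
        rw [e1, e2, Real.sin_sub, Real.sin_add]
        ring
      simp only [h3]
      rw [intervalIntegral.integral_add, mul_add, ih, ih, ballot, Nat.cast_add]
      · exact (by fun_prop : Continuous _).intervalIntegrable _ _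
      · exact (by fun_prop : Continuous _).intervalIntegrable _ _

/-- The density of the semicircle law. -/
noncomputable def semicircleDensity (x : ℝ) : ℝ :=
  1 / (2 * Real.pi) * (Set.Icc (-2 : ℝ) 2).indicator (fun x => Real.sqrt (4 - x ^ 2)) x

theorem semicircleDensity_nonneg (x : ℝ) : 0 ≤ semicircleDensity x := by
  have := Real.pi_pos
  exact mul_nonneg (by positivity) (Set.indicator_nonneg (fun _ _ => Real.sqrt_nonneg _) _)

theorem measurable_semicircleDensity : Measurable semicircleDensity :=
  measurable_const.mul (Measurable.indicator (by fun_prop) measurableSet_Icc)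

theorem semicircleDensity_mul_eq_indicator (f : ℝ → ℝ) :
    (fun x => semicircleDensity x * f x) = (Set.Icc (-2 : ℝ) 2).indicator
      (fun x => 1 / (2 * Real.pi) * Real.sqrt (4 - x ^ 2) * f x) := by
  ext x
  rw [semicircleDensity]
  by_cases hx : x ∈ Set.Icc (-2 : ℝ) 2 <;> simp [hx]

theorem integrable_semicircleDensity_mul {f : ℝ → ℝ} (hf : Continuous f) :
    Integrable (fun x => semicircleDensity x * f x) := by
  rw [semicircleDensity_mul_eq_indicator, integrable_indicator_iff measurableSet_Icc]
  exact (by fun_prop : Continuous _).continuousOn.integrableOn_Icc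

theorem integral_semicircleDensity_mul {f : ℝ → ℝ} (hf : Continuous f) :
    ∫ x, semicircleDensity x * f x =
      2 / Real.pi * ∫ θ in (0 : ℝ)..Real.pi, f (2 * Real.cos θ) * (Real.sin θ * Real.sin θ) := by
  rw [semicircleDensity_mul_eq_indicator, integral_indicator measurableSet_Icc,
    integral_Icc_eq_integral_Ioc, ← intervalIntegral.integral_of_le (by norm_num)]
  have h := intervalIntegral.integral_comp_mul_deriv (a := 0) (b := Real.pi)
    (f := fun θ => 2 * Real.cos θ) (f' := fun θ => 2 * -Real.sin θ)
    (g := fun x => 1 / (2 * Real.pi) * Real.sqrt (4 - x ^ 2) * f x)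
    (fun x _ => (Real.hasDerivAt_cos x).const_mul 2) (by fun_prop) (by fun_prop)
  simp only [Real.cos_zero, Real.cos_pi, mul_one, mul_neg, Function.comp_def] at h
  -- As `θ` runs from `0` to `π`, `2 cos θ` runs from `2` down to `-2`; the reversed orientation
  -- cancels the sign of the derivative.
  rw [intervalIntegral.integral_symm, ← h, ← intervalIntegral.integral_neg,
    ← intervalIntegral.integral_const_mul]
  refine intervalIntegral.integral_congr fun θ hθ => ?_
  rw [Set.uIcc_of_le Real.pi_pos.le] at hθ
  have h1 : Real.sqrt (4 - (2 * Real.cos θ) ^ 2) = 2 * Real.sin θ := by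
    rw [show 4 - (2 * Real.cos θ) ^ 2 = (2 * Real.sin θ) ^ 2 by
      nlinarith [Real.sin_sq_add_cos_sq θ]]
    exact Real.sqrt_sq (mul_nonneg two_pos.le (Real.sin_nonneg_of_mem_Icc hθ))
  have := Real.pi_ne_zero
  simp only [h1]
  field_simp

theorem semicircleLaw_eq :
    semicircleLaw = volume.withDensity fun x => ENNReal.ofReal (semicircleDensity x) := rfl

theorem integral_semicircleLaw (f : ℝ → ℝ) :
    ∫ x, f x ∂semicircleLaw = ∫ x, semicircleDensity x * f x := by
  rw [semicircleLaw_eq, integral_withDensity_eq_integral_toReal_smul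
    measurable_semicircleDensity.ennreal_ofReal (by simp)]
  simp only [ENNReal.toReal_ofReal (semicircleDensity_nonneg _), smul_eq_mul]

theorem integral_pow_semicircleLaw (k : ℕ) : ∫ x, x ^ k ∂semicircleLaw = ballot k 1 := by
  rw [integral_semicircleLaw, integral_semicircleDensity_mul (by fun_prop),
    ← integral_two_cos_pow_mul_sin_mul_sin]
  simp

instance : IsProbabilityMeasure semicircleLaw := by
  constructor
  have h1 := integral_pow_semicircleLaw 0
  rw [integral_semicircleLaw] at h1
  have h2 := integrable_semicircleDensity_mul (f := fun _ => 1) continuous_const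
  simp only [mul_one, pow_zero] at h1 h2
  rw [semicircleLaw_eq, withDensity_apply _ MeasurableSet.univ, setLIntegral_univ,
    ← ofReal_integral_eq_lintegral_ofReal h2 (ae_of_all _ semicircleDensity_nonneg), h1]
  simp [ballot]

theorem semicircleLaw_compl_Icc : semicircleLaw (Set.Icc (-2 : ℝ) 2)ᶜ = 0 := by
  rw [semicircleLaw_eq, withDensity_apply _ measurableSet_Icc.compl]
  refine (setLIntegral_congr_fun measurableSet_Icc.compl fun x hx => ?_).trans lintegral_zero
  rw [semicircleDensity, Set.indicator_of_notMem hx, mul_zero, ENNReal.ofReal_zero]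

end Semicircle

/-! ### The method of moments -/

section MethodOfMoments

/-- Outside `[-3, 3]` both `f` and `p` are bounded by a multiple of `|x| ^ D`, which is at most `3 ^
D * (x / 3) ^ (2 * j)`. Since `C` does not depend on `j`, the exponent can be chosen afterwards. -/
theorem exists_abs_sub_eval_le (f : ℝ →ᵇ ℝ) (p : Polynomial ℝ) {ε : ℝ} (hε : 0 ≤ ε)
    (hp : ∀ x ∈ Set.Icc (-3 : ℝ) 3, |f x - p.eval x| ≤ ε) : ∃ C : ℝ, 0 ≤ C ∧
      ∀ j, p.natDegree ≤ 2 * j → ∀ x, |f x - p.eval x| ≤ ε + C * (x / 3) ^ (2 * j) := by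
  set D := p.natDegree
  set C := ‖f‖ + ∑ i ∈ Finset.range (D + 1), |p.coeff i| with hC
  have hC0 : 0 ≤ C := by positivity
  refine ⟨C * 3 ^ D, by positivity, fun j hj x => ?_⟩
  by_cases hx : |x| ≤ 3
  · refine (hp x (abs_le.1 hx)).trans (le_add_of_nonneg_right ?_)
    rw [pow_mul]
    positivity
  · push Not at hx
    have h1 : (1 : ℝ) ≤ |x| := by linarith
    have h2 : |p.eval x| ≤ (∑ i ∈ Finset.range (D + 1), |p.coeff i|) * |x| ^ D := by
      rw [Polynomial.eval_eq_sum_range, Finset.sum_mul]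
      refine (Finset.abs_sum_le_sum_abs _ _).trans (Finset.sum_le_sum fun i hi => ?_)
      rw [abs_mul, abs_pow]
      gcongr
      exact Nat.lt_succ_iff.1 (Finset.mem_range.1 hi)
    have h3 : |f x| ≤ ‖f‖ * |x| ^ D :=
      (f.norm_coe_le_norm x).trans (le_mul_of_one_le_right (norm_nonneg _) (one_le_pow₀ h1))
    have h4 : |f x - p.eval x| ≤ C * |x| ^ D := by
      rw [hC, add_mul]
      exact (abs_sub _ _).trans (add_le_add h3 h2)
    have h5 : |x| ^ D ≤ 3 ^ D * (x / 3) ^ (2 * j) := by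
      have e : (x / 3) ^ (2 * j) = (|x| / 3) ^ (2 * j) := by
        rw [div_pow, div_pow, pow_mul |x| 2 j, sq_abs, ← pow_mul]
      rw [e]
      calc |x| ^ D = 3 ^ D * (|x| / 3) ^ D := by
            rw [div_pow]
            field_simp
        _ ≤ _ := by
          gcongr
          rw [le_div_iff₀] <;> linarith
    calc _ ≤ _ := h4
      _ ≤ C * (3 ^ D * (x / 3) ^ (2 * j)) := by gcongr
      _ = C * 3 ^ D * (x / 3) ^ (2 * j) := by ring
      _ ≤ _ := le_add_of_nonneg_left hε

theorem integrable_eval {μ : Measure ℝ} (hμ : ∀ k : ℕ, Integrable (fun x : ℝ => x ^ k) μ)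
    (p : Polynomial ℝ) : Integrable (fun x => p.eval x) μ := by
  simp only [Polynomial.eval_eq_sum_range]
  exact integrable_finsetSum _ fun i _ => (hμ i).const_mul _

theorem integral_eval {μ : Measure ℝ} (hμ : ∀ k : ℕ, Integrable (fun x : ℝ => x ^ k) μ)
    (p : Polynomial ℝ) :
    ∫ x, p.eval x ∂μ = ∑ i ∈ Finset.range (p.natDegree + 1), p.coeff i * ∫ x, x ^ i ∂μ := by
  simp only [Polynomial.eval_eq_sum_range]
  rw [integral_finsetSum _ fun i _ => (hμ i).const_mul _]
  simp only [integral_const_mul]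

/-- The method of moments, for a limit that is supported in `[-2, 2]`. -/
theorem convergesWeakly_of_tendsto_moments {μ : ℕ → Measure ℝ} {ν : Measure ℝ}
    [IsProbabilityMeasure ν] (hν : ν (Set.Icc (-2 : ℝ) 2)ᶜ = 0)
    (hμ : ∀ᶠ n in atTop, IsProbabilityMeasure (μ n) ∧
      ∀ k : ℕ, Integrable (fun x : ℝ => x ^ k) (μ n))
    (hm : ∀ k : ℕ, Tendsto (fun n => ∫ x, x ^ k ∂(μ n)) atTop (𝓝 (∫ x, x ^ k ∂ν))) :
    ConvergesWeakly μ ν := by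
  have hν' : ∀ᵐ x ∂ν, x ∈ Set.Icc (-2 : ℝ) 2 := hν
  have hνint : ∀ k : ℕ, Integrable (fun x : ℝ => x ^ k) ν := by
    intro k
    refine Integrable.of_bound (C := 2 ^ k) (by fun_prop) ?_
    filter_upwards [hν'] with x hx
    rw [norm_pow]
    gcongr
    exact abs_le.2 hx
  have hνmom : ∀ j, ∫ x, x ^ (2 * j) ∂ν ≤ 4 ^ j := by
    intro j
    have h1 : ∫ x, x ^ (2 * j) ∂ν ≤ ∫ x, (4 : ℝ) ^ j ∂ν := by
      refine integral_mono_ae (hνint _) (integrable_const _) ?_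
      filter_upwards [hν'] with x hx
      rw [pow_mul]
      gcongr
      nlinarith [hx.1, hx.2]
    simpa using h1
  intro f
  rw [Metric.tendsto_atTop']
  intro δ hδ
  obtain ⟨ε, hεδ⟩ : ∃ ε, ε = δ / 6 := ⟨_, rfl⟩
  have hε : 0 < ε := by rw [hεδ]; positivity
  obtain ⟨p, hp⟩ := exists_polynomial_near_of_continuousOn (-3) 3 f f.continuous.continuousOn ε hε
  have hp' : ∀ x ∈ Set.Icc (-3 : ℝ) 3, |f x - p.eval x| ≤ ε := fun x hx => by
    rw [abs_sub_comm]
    exact (hp x hx).le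
  obtain ⟨C, hC, hfp⟩ := exists_abs_sub_eval_le f p hε.le hp'
  -- The limit law lives on `[-2, 2]`, so its moment of order `2 * j` divided by `9 ^ j` is at most
  -- `(4/9) ^ j`. This leaves room to control the tails outside `[-3, 3]`.
  obtain ⟨j, hj, hjC⟩ : ∃ j, p.natDegree ≤ 2 * j ∧ C * (4 / 9) ^ j < ε := by
    have h1 : Tendsto (fun j : ℕ => C * (4 / 9 : ℝ) ^ j) atTop (𝓝 (C * 0)) :=
      (tendsto_pow_atTop_nhds_zero_of_lt_one (by norm_num) (by norm_num)).const_mul C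
    rw [mul_zero] at h1
    obtain ⟨j, h2, h3⟩ := ((h1.eventually_lt_const hε).and
      (eventually_ge_atTop p.natDegree)).exists
    exact ⟨j, by omega, h2⟩
  have t1 : Tendsto (fun n => ∫ x, p.eval x ∂(μ n)) atTop (𝓝 (∫ x, p.eval x ∂ν)) := by
    rw [integral_eval hνint]
    refine (tendsto_congr' ?_).2 (tendsto_finsetSum _ fun i _ => (hm i).const_mul (p.coeff i))
    filter_upwards [hμ] with n hn
    exact integral_eval hn.2 p
  have t2 : Tendsto (fun n => C * ((∫ x, x ^ (2 * j) ∂(μ n)) / 9 ^ j)) atTop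
      (𝓝 (C * ((∫ x, x ^ (2 * j) ∂ν) / 9 ^ j))) := ((hm (2 * j)).div_const _).const_mul C
  have t3 : C * ((∫ x, x ^ (2 * j) ∂ν) / 9 ^ j) < ε := by
    refine lt_of_le_of_lt ?_ hjC
    rw [div_pow]
    have := hνmom j
    gcongr
  have hν1 : |∫ x, p.eval x ∂ν - ∫ x, f x ∂ν| ≤ ε := by
    rw [← integral_sub (integrable_eval hνint p) (f.integrable ν)]
    have h : ∀ᵐ x ∂ν, ‖p.eval x - f x‖ ≤ ε := by
      filter_upwards [hν'] with x hx
      rw [Real.norm_eq_abs, abs_sub_comm]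
      exact hp' x ⟨by linarith [hx.1], by linarith [hx.2]⟩
    simpa using norm_integral_le_of_norm_le_const h
  have hev : ∀ᶠ n in atTop, dist (∫ x, f x ∂(μ n)) (∫ x, f x ∂ν) < δ := by
    filter_upwards [hμ, Metric.tendsto_nhds.1 t1 ε hε, t2.eventually_lt_const t3] with n hn h1 h2
    have := hn.1
    have h3 : |∫ x, f x ∂(μ n) - ∫ x, p.eval x ∂(μ n)| ≤ ε + ε := by
      rw [← integral_sub (f.integrable _) (integrable_eval hn.2 p)]
      have hi : Integrable (fun x : ℝ => ε + C * (x / 3) ^ (2 * j)) (μ n) := by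
        simp only [div_pow]
        exact (integrable_const _).add (((hn.2 (2 * j)).div_const _).const_mul C)
      have hb : ∀ᵐ x ∂(μ n), ‖f x - p.eval x‖ ≤ ε + C * (x / 3) ^ (2 * j) :=
        ae_of_all _ fun x => hfp j hj x
      refine (norm_integral_le_of_norm_le hi hb).trans ?_
      have e : ∫ x, (ε + C * (x / 3) ^ (2 * j)) ∂(μ n) =
          ε + C * ((∫ x, x ^ (2 * j) ∂(μ n)) / 9 ^ j) := by
        have h9 : (3 : ℝ) ^ (2 * j) = 9 ^ j := by
          rw [pow_mul]
          norm_num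
        simp only [div_pow, h9]
        rw [integral_add (integrable_const _) (((hn.2 (2 * j)).div_const _).const_mul C),
          integral_const_mul, integral_div, integral_const, probReal_univ, one_smul]
      rw [e]
      linarith
    rw [Real.dist_eq] at h1 ⊢
    calc |∫ x, f x ∂(μ n) - ∫ x, f x ∂ν| = |(∫ x, f x ∂(μ n) - ∫ x, p.eval x ∂(μ n)) +
          (∫ x, p.eval x ∂(μ n) - ∫ x, p.eval x ∂ν) +
          (∫ x, p.eval x ∂ν - ∫ x, f x ∂ν)| := by ring_nf
      _ ≤ _ := abs_add_three _ _ _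
      _ < δ := by linarith
  obtain ⟨N, hN⟩ := eventually_atTop.1 hev
  exact ⟨N, fun n hn => hN n hn.le⟩

end MethodOfMoments

/-! ### Measurability and moments of the empirical measure -/

section EmpiricalMeasure

variable {ι : Type} [Fintype ι] [DecidableEq ι]

theorem Matrix.IsHermitian.trace_pow_eq {M : Matrix ι ι ℂ} (hM : M.IsHermitian) (k : ℕ) :
    (M ^ k).trace = ((∑ j, hM.eigenvalues j ^ k : ℝ) : ℂ) := by
  conv_lhs => rw [hM.spectral_theorem]
  rw [← map_pow, Unitary.conjStarAlgAut_apply, Matrix.trace_mul_comm, ← mul_assoc,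
    Unitary.coe_star_mul_self, one_mul, Matrix.diagonal_pow, Matrix.trace_diagonal]
  simp

theorem integrable_empiricalMeasure [Nonempty ι] (M : Matrix ι ι ℂ) (hM : M.IsHermitian)
    (f : ℝ → ℝ) : Integrable f (empiricalMeasure M hM) := by
  refine Integrable.smul_measure ?_ (by simp)
  rw [integrable_finsetSum_measure]
  intro j _
  exact integrable_dirac (by simp)

theorem integral_empiricalMeasure [Nonempty ι] (M : Matrix ι ι ℂ) (hM : M.IsHermitian)
    (f : ℝ → ℝ) : ∫ x, f x ∂(empiricalMeasure M hM) =
      (Fintype.card ι : ℝ)⁻¹ * ∑ j, f (hM.eigenvalues j) := by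
  rw [empiricalMeasure, integral_smul_measure, integral_finsetSum_measure]
  · simp
  · intro j _
    exact integrable_dirac (by simp)

instance [Nonempty ι] (M : Matrix ι ι ℂ) (hM : M.IsHermitian) :
    IsProbabilityMeasure (empiricalMeasure M hM) := by
  constructor
  simp only [empiricalMeasure, Measure.smul_apply, Measure.coe_finsetSum, Finset.sum_apply,
    measure_univ, Finset.sum_const, Finset.card_univ, nsmul_eq_mul, mul_one, smul_eq_mul]
  exact ENNReal.inv_mul_cancel (by simp) (by simp)

variable {Ω : Type*} [MeasurableSpace Ω] {X : Ω → Matrix ι ι ℂ}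
  (hX : ∀ ω, (X ω).IsHermitian)

theorem measurable_trace_pow (hmeas : ∀ p q, Measurable fun ω => X ω p q) (k : ℕ) : Measurable fun ω => (X ω ^ k).trace := by
  have h : ∀ k p q, Measurable fun ω => (X ω ^ k) p q := by
    intro k
    induction k with
    | zero => exact fun p q => by simp
    | succ k ih =>
      intro p q
      simp only [pow_succ, Matrix.mul_apply]
      exact Finset.measurable_sum _ fun x _ => (ih p x).mul (hmeas x q)
  exact Finset.measurable_sum _ fun p _ => h k p p

/-- Power sums of the eigenvalues are traces of powers, thus polynomials in the entries;
measurability of individual eigenvalues is never needed. -/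
theorem measurable_sum_pow_eigenvalues (hmeas : ∀ p q, Measurable fun ω => X ω p q) (k : ℕ) :
    Measurable fun ω => ∑ j, (hX ω).eigenvalues j ^ k := by
  have : (fun ω => ∑ j, (hX ω).eigenvalues j ^ k) = fun ω => ((X ω ^ k).trace).re := by
    ext ω
    rw [(hX ω).trace_pow_eq, Complex.ofReal_re]
  rw [this]
  exact Complex.measurable_re.comp (measurable_trace_pow hmeas k)

theorem measurable_sum_eval_eigenvalues (hmeas : ∀ p q, Measurable fun ω => X ω p q) (p : Polynomial ℝ) :
    Measurable fun ω => ∑ j, p.eval ((hX ω).eigenvalues j) := by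
  simp only [Polynomial.eval_eq_sum_range]
  simp only [Finset.sum_comm (s := Finset.univ), ← Finset.mul_sum]
  exact Finset.measurable_sum _ fun i _ =>
    (measurable_sum_pow_eigenvalues hX hmeas i).const_mul _

theorem measurable_sum_eigenvalues (hmeas : ∀ p q, Measurable fun ω => X ω p q) {f : ℝ → ℝ} (hf : Continuous f) :
    Measurable fun ω => ∑ j, f ((hX ω).eigenvalues j) := by
  choose p hp using fun n : ℕ => exists_polynomial_near_of_continuousOn (-n) n f
    hf.continuousOn (1 / ((n : ℝ) + 1)) (by positivity)
  -- The condition on the sum of squares is measurable, holds eventually for each `ω`, and forces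
  -- all eigenvalues into `[-n, n]`, where the `n`-th polynomial is within `1 / (n + 1)` of `f`.
  refine measurable_of_tendsto_metrizable
    (f := fun n ω => if ∑ j, (hX ω).eigenvalues j ^ 2 ≤ (n : ℝ) ^ 2 then
      ∑ j, (p n).eval ((hX ω).eigenvalues j) else 0)
    (fun n => Measurable.ite (measurableSet_le (measurable_sum_pow_eigenvalues hX hmeas 2)
      measurable_const) (measurable_sum_eval_eigenvalues hX hmeas _) measurable_const) ?_
  rw [tendsto_pi_nhds]
  intro ω
  rw [tendsto_iff_dist_tendsto_zero]
  have h0 : Tendsto (fun n : ℕ => (Fintype.card ι : ℝ) * (1 / ((n : ℝ) + 1))) atTop (𝓝 0) := by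
    simpa using tendsto_one_div_add_atTop_nhds_zero_nat.const_mul (Fintype.card ι : ℝ)
  refine tendsto_of_tendsto_of_tendsto_of_le_of_le' tendsto_const_nhds h0
    (Eventually.of_forall fun _ => dist_nonneg) ?_
  have hn : ∀ᶠ n : ℕ in atTop, ∑ j, (hX ω).eigenvalues j ^ 2 ≤ (n : ℝ) ^ 2 :=
    ((tendsto_pow_atTop two_ne_zero).comp tendsto_natCast_atTop_atTop).eventually_ge_atTop _
  filter_upwards [hn] with n hn
  simp only [if_pos hn]
  rw [Real.dist_eq, ← Finset.sum_sub_distrib]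
  refine (Finset.abs_sum_le_sum_abs _ _).trans ?_
  rw [← nsmul_eq_mul, ← Finset.card_univ]
  refine Finset.sum_le_card_nsmul _ _ _ fun j _ => (hp n _ ?_).le
  have h1 : (hX ω).eigenvalues j ^ 2 ≤ (n : ℝ) ^ 2 :=
    (Finset.single_le_sum (f := fun j => (hX ω).eigenvalues j ^ 2)
      (fun _ _ => sq_nonneg _) (Finset.mem_univ j)).trans hn
  exact abs_le.1 (abs_le_of_sq_le_sq h1 (Nat.cast_nonneg n))

theorem measurable_empiricalMeasure (hmeas : ∀ p q, Measurable fun ω => X ω p q) [Nonempty ι] :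
    Measurable fun ω => empiricalMeasure (X ω) (hX ω) := by
  refine Measurable.measure_of_isPiSystem_of_isProbabilityMeasure
    (borel_eq_generateFrom_Iic ℝ) isPiSystem_Iic ?_
  rintro _ ⟨t, rfl⟩
  have h1 : ∀ ω, empiricalMeasure (X ω) (hX ω) (Set.Iic t) = ENNReal.ofReal
      ((Fintype.card ι : ℝ)⁻¹ * ∑ j, (Set.Iic t).indicator 1 ((hX ω).eigenvalues j)) := by
    intro ω
    rw [← integral_empiricalMeasure, integral_indicator_one measurableSet_Iic,
      ofReal_measureReal]
  simp only [h1]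
  refine (Measurable.const_mul ?_ _).ennreal_ofReal
  -- The indicator of `(-∞, t]` is the pointwise limit of continuous functions equal to `1` up to
  -- `t` and falling linearly to `0` on an interval of length `1/n`.
  refine measurable_of_tendsto_metrizable
    (f := fun (n : ℕ) ω => ∑ j, max 0 (min 1 (1 - n * ((hX ω).eigenvalues j - t))))
    (fun n => measurable_sum_eigenvalues hX hmeas
      (f := fun x => max 0 (min 1 (1 - n * (x - t)))) (by fun_prop)) ?_
  rw [tendsto_pi_nhds]
  intro ω
  refine tendsto_finsetSum _ fun j _ => ?_
  generalize (hX ω).eigenvalues j = x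
  refine (tendsto_congr' ?_).2 tendsto_const_nhds
  by_cases hx : x ≤ t
  · filter_upwards with n
    have : 0 ≤ (n : ℝ) * (t - x) := mul_nonneg (Nat.cast_nonneg n) (by linarith)
    rw [Set.indicator_of_mem (Set.mem_Iic.2 hx), min_eq_left (by linarith), max_eq_right zero_le_one]
    rfl
  · push Not at hx
    have hn : ∀ᶠ n : ℕ in atTop, 1 ≤ (n : ℝ) * (x - t) :=
      (tendsto_natCast_atTop_atTop.atTop_mul_const (sub_pos.2 hx)).eventually_ge_atTop _
    filter_upwards [hn] with n hn
    rw [Set.indicator_of_notMem (by simpa using hx)]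
    exact max_eq_left ((min_le_right _ _).trans (by linarith))

variable {P : Measure Ω} [IsProbabilityMeasure P] [Nonempty ι]

theorem isProbabilityMeasure_meanEmpiricalMeasure (hmeas : ∀ p q, Measurable fun ω => X ω p q) :
    IsProbabilityMeasure (meanEmpiricalMeasure P X hX) :=
  isProbabilityMeasure_bind (measurable_empiricalMeasure hX hmeas).aemeasurable
    (ae_of_all _ fun _ => inferInstance)

theorem integrable_pow_meanEmpiricalMeasure (hmeas : ∀ p q, Measurable fun ω => X ω p q)
    (hint : ∀ k : ℕ, Integrable (fun ω => (X ω ^ k).trace) P) (k : ℕ) :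
    Integrable (fun x : ℝ => x ^ k) (meanEmpiricalMeasure P X hX) := by
  let κ : Kernel Ω ℝ := ⟨fun ω => empiricalMeasure (X ω) (hX ω),
    measurable_empiricalMeasure hX hmeas⟩
  refine (Measure.integrable_comp_iff (κ := κ) (by fun_prop)).2
    ⟨ae_of_all _ fun ω => integrable_empiricalMeasure _ _ _, ?_⟩
  have h1 : ∀ ω, ∫ x, ‖x ^ k‖ ∂(κ ω) =
      (Fintype.card ι : ℝ)⁻¹ * ∑ j, ‖(hX ω).eigenvalues j ^ k‖ := fun ω =>
    integral_empiricalMeasure _ _ _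
  simp only [h1]
  refine Integrable.const_mul ?_ _
  -- Absolute moments are not traces for odd `k`, but `|x| ^ k ≤ 1 + x ^ (2 * k)` reduces them to
  -- the trace of an even power.
  have h2 : Integrable (fun ω => ∑ j, (1 + (hX ω).eigenvalues j ^ (2 * k))) P := by
    simp only [Finset.sum_add_distrib]
    refine (integrable_const _).add ?_
    have h3 : Integrable (fun ω => ((X ω ^ (2 * k)).trace).re) P := (hint (2 * k)).re
    simpa only [(hX _).trace_pow_eq, Complex.ofReal_re] using h3
  refine h2.mono' (measurable_sum_eigenvalues hX hmeas
    (f := fun x => ‖x ^ k‖) (by fun_prop)).aestronglyMeasurable (ae_of_all _ fun ω => ?_)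
  rw [Real.norm_of_nonneg (Finset.sum_nonneg fun _ _ => norm_nonneg _)]
  refine Finset.sum_le_sum fun j _ => ?_
  rw [Real.norm_eq_abs, mul_comm, pow_mul, ← sq_abs (_ ^ k)]
  nlinarith [sq_nonneg (|(hX ω).eigenvalues j ^ k| - 1), abs_nonneg ((hX ω).eigenvalues j ^ k)]

theorem integral_pow_meanEmpiricalMeasure (hmeas : ∀ p q, Measurable fun ω => X ω p q)
    (hint : ∀ k : ℕ, Integrable (fun ω => (X ω ^ k).trace) P) (k : ℕ) :
    ∫ x, x ^ k ∂(meanEmpiricalMeasure P X hX) =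
      (Fintype.card ι : ℝ)⁻¹ * (∫ ω, (X ω ^ k).trace ∂P).re := by
  let κ : Kernel Ω ℝ := ⟨fun ω => empiricalMeasure (X ω) (hX ω),
    measurable_empiricalMeasure hX hmeas⟩
  have hcomp : meanEmpiricalMeasure P X hX = (κ ∘ₖ Kernel.const Unit P) () := by
    have h0 : meanEmpiricalMeasure P X hX = κ ∘ₘ P := rfl
    rw [h0, Measure.comp_eq_comp_const_apply]
  have hi := integrable_pow_meanEmpiricalMeasure hX hmeas hint k
  rw [hcomp] at hi ⊢
  have h := Kernel.integral_comp hi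
  rw [Kernel.const_apply] at h
  have h1 : ∀ ω, ∫ x, x ^ k ∂(κ ω) =
      (Fintype.card ι : ℝ)⁻¹ * ∑ j, (hX ω).eigenvalues j ^ k := fun ω =>
    integral_empiricalMeasure _ _ _
  simp only [h1] at h
  rw [integral_const_mul] at h
  simp only [(hX _).trace_pow_eq]
  rw [integral_complex_ofReal, Complex.ofReal_re]
  exact h

end EmpiricalMeasure

/-! ### The forced zeros of the symmetry classes -/

namespace SymClass

/-- The position of an index in its block. -/
def blockIndex : (c : SymClass) → (n : ℕ) → c.Index n → Fin n
  | A, _, p | AI, _, p | BD, _, p => p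
  | AII, _, p | C, _, p | CI, _, p | DIII, _, p => Sum.elim id id p

theorem exists_real_symmetric (n : ℕ) : ∃ Y : Matrix (Fin n) (Fin n) ℂ,
    EntriesReal Y ∧ Y.transpose = Y ∧ ∀ i j, Y i j ≠ 0 :=
  ⟨Matrix.of fun _ _ => 1, by simp [EntriesReal], by ext; simp, by simp⟩

theorem exists_imaginary_skewSymmetric (n : ℕ) : ∃ Z : Matrix (Fin n) (Fin n) ℂ,
    EntriesImaginary Z ∧ Z.transpose = -Z ∧ ∀ i j, i ≠ j → Z i j ≠ 0 := by
  refine ⟨Matrix.of fun i j => if i < j then Complex.I else if j < i then -Complex.I else 0,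
    ?_, ?_, ?_⟩
  · intro i j
    simp only [Matrix.of_apply]
    split_ifs <;> simp
  · ext1 i j
    rcases lt_trichotomy i j with h | rfl | h
    · simp [h, h.not_gt]
    · simp
    · simp [h, h.not_gt]
  · intro i j hij
    rcases lt_or_gt_of_ne hij with h | h
    · simp [h]
    · simp [h, h.not_gt]

/-- Two matrices serve as blocks for all classes: the all-ones matrix and an imaginary skew
symmetric one without zeros off the diagonal. Both are hermitian, and forced zeros can only occur on
the diagonals of blocks. -/
theorem mem_support_of_blockIndex_ne {c : SymClass} {n : ℕ} {p q : c.Index n}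
    (h : c.blockIndex n p ≠ c.blockIndex n q) : (p, q) ∈ c.support n := by
  obtain ⟨Y, hY1, hY2, hY3⟩ := exists_real_symmetric n
  obtain ⟨Z, hZ1, hZ2, hZ3⟩ := exists_imaginary_skewSymmetric n
  have hY := conjTranspose_of_real hY1 hY2
  have hZ := conjTranspose_of_imaginary hZ1 hZ2
  cases c
  case A => exact ⟨Z, hZ, hZ3 _ _ h⟩
  case AI => exact ⟨Y, ⟨hY1, hY2⟩, hY3 _ _⟩
  case BD => exact ⟨Z, ⟨hZ1, hZ2⟩, hZ3 _ _ h⟩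
  case AII =>
    refine ⟨_, ⟨Z, Z, hZ, hZ2, rfl⟩, ?_⟩
    rcases p with p | p <;> rcases q with q | q <;> simpa using hZ3 p q h
  case C =>
    refine ⟨_, ⟨Y, Y, hY, hY2, rfl⟩, ?_⟩
    rcases p with p | p <;> rcases q with q | q <;> simpa using hY3 _ _
  case CI =>
    refine ⟨_, ⟨Y, Y, hY1, hY1, hY2, hY2, rfl⟩, ?_⟩
    rcases p with p | p <;> rcases q with q | q <;> simpa using hY3 _ _
  case DIII =>
    refine ⟨_, ⟨Z, Z, hZ1, hZ1, hZ2, hZ2, rfl⟩, ?_⟩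
    rcases p with p | p <;> rcases q with q | q <;> simpa using hZ3 p q h

theorem exists_card_le_two_of_blockIndex_eq (c : SymClass) (n : ℕ) (i : Fin n) :
    ∃ F : Finset (c.Index n), F.card ≤ 2 ∧ ∀ q, c.blockIndex n q = i → q ∈ F := by
  have h1 : ∃ F : Finset (Fin n), F.card ≤ 2 ∧ ∀ q : Fin n, q = i → q ∈ F :=
    ⟨{i}, by simp, by simp⟩
  have h2 : ∃ F : Finset (Fin n ⊕ Fin n), F.card ≤ 2 ∧
      ∀ q : Fin n ⊕ Fin n, Sum.elim id id q = i → q ∈ F :=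
    ⟨{Sum.inl i, Sum.inr i}, Finset.card_le_two, by
      rintro (q | q) rfl <;> simp⟩
  cases c
  case A => exact h1
  case AI => exact h1
  case BD => exact h1
  all_goals exact h2

open scoped Classical in
theorem card_filter_notMem_support_le (c : SymClass) (n : ℕ) (p : c.Index n) :
    (Finset.univ.filter fun q => (p, q) ∉ c.support n).card ≤ 2 := by
  obtain ⟨F, hF, h⟩ := c.exists_card_le_two_of_blockIndex_eq n (c.blockIndex n p)
  refine (Finset.card_le_card fun q hq => ?_).trans hF
  rw [Finset.mem_filter] at hq
  by_contra hqF
  exact hq.2 (mem_support_of_blockIndex_ne fun hpq => hqF (h q hpq.symm))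

theorem tendsto_card_index (c : SymClass) :
    Tendsto (fun n => Fintype.card (c.Index n)) atTop atTop := by
  refine tendsto_atTop_mono (fun n => ?_) tendsto_id
  rw [card_index]
  exact Nat.le_mul_of_pos_left n (by cases c <;> simp [delta])

end SymClass

/-! ### Convergence of the expected traces -/

section Moments

open scoped Classical

theorem equivCount_le {ι : Type} [Fintype ι] (r : Setoid (ι × ι)) :
    equivCount r ≤ Fintype.card ι * Finset.univ.sup fun p : ι =>
      {t : ι × ι × ι | r (p, t.1) (t.2.1, t.2.2)}.ncard := by
  have h : equivCount r = ∑ p : ι, {t : ι × ι × ι | r (p, t.1) (t.2.1, t.2.2)}.ncard := by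
    rw [equivCount, Finset.card_filter]
    simp only [Fintype.sum_prod_type]
    refine Finset.sum_congr rfl fun p _ => ?_
    rw [Set.ncard_eq_toFinset_card', Set.toFinset_ofPred, Finset.card_filter]
    simp only [Fintype.sum_prod_type]
  rw [h, ← smul_eq_mul, ← Finset.card_univ]
  exact Finset.sum_le_card_nsmul _ _ _ fun p hp =>
    Finset.le_sup (f := fun p : ι => {t : ι × ι × ι | r (p, t.1) (t.2.1, t.2.2)}.ncard) hp

theorem pathCount_eq {ι : Type} [Fintype ι] (r : Setoid (ι × ι)) :
    pathCount r = {t : ι × ι × ι | r (t.1, t.2.1) (t.2.1, t.2.2) ∧ t.1 ≠ t.2.2}.ncard := by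
  rw [pathCount, Set.ncard_eq_toFinset_card', Set.toFinset_ofPred]

/-- The expectations of traces of powers under the conditions on the equivalence relations. -/
theorem tendsto_integral_trace_pow {ι : ℕ → Type} [∀ n, Fintype (ι n)] [∀ n, DecidableEq (ι n)]
    {Ω : ℕ → Type*} [∀ n, MeasurableSpace (Ω n)]
    (P : ∀ n, Measure (Ω n)) [∀ n, IsProbabilityMeasure (P n)]
    (a : ∀ n, ι n → ι n → Ω n → ℂ) (r : ∀ n, Setoid (ι n × ι n)) (S : ∀ n, Set (ι n × ι n))
    (hcard : Tendsto (fun n => Fintype.card (ι n)) atTop atTop)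
    (hmeas : ∀ n p q, Measurable (a n p q))
    (hindep : ∀ n p q, IndepFun (a n p q)
      (fun ω (t : {t : ι n × ι n // ¬r n (p, q) t}) => a n t.1.1 t.1.2 ω) (P n))
    (hW1 : ConditionW1 ι r) (hW2 : ConditionW2 ι r) (hW3 : ConditionW3 ι r)
    (hmom : ∀ k : ℕ, ∃ K : ℝ≥0, ∀ n p q, ∫⁻ ω, ‖a n p q ω‖ₑ ^ k ∂(P n) ≤ K)
    (hcent : ∀ n p q, ∫ ω, a n p q ω ∂(P n) = 0)
    (hvar : ∀ n p q, (p, q) ∈ S n → ∫ ω, a n p q ω * starRingEnd ℂ (a n p q ω) ∂(P n) = 1)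
    (hstar : ∀ n p q ω, a n q p ω = starRingEnd ℂ (a n p q ω))
    (hzero : ∀ n p q, (p, q) ∉ S n → ∀ ω, a n p q ω = 0)
    (hS : ∀ n p, (Finset.univ.filter fun q => (p, q) ∉ S n).card ≤ 2) (k : ℕ) :
    Tendsto (fun n => (∫ ω, ((Matrix.of fun p q => a n p q ω) ^ k).trace ∂(P n)).re /
      √(Fintype.card (ι n)) ^ (k + 2)) atTop (𝓝 (ballot k 1)) := by
  obtain ⟨B, hB⟩ := hW2
  have hswap : ∀ n p q, (p, q) ∈ S n → r n (p, q) (q, p) := fun n =>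
    equiv_swap (hmeas n) (hindep n) (hstar n) (hvar n) (hcent n)
  obtain ⟨K, hK⟩ := hmom k
  obtain ⟨C, hC, hneg⟩ := listCount_negligible_le B k
  have htree := tendsto_treeCount r S hcard hswap hB hS k 1
  have hcard' : Tendsto (fun n => (Fintype.card (ι n) : ℝ)) atTop atTop :=
    tendsto_natCast_atTop_atTop.comp hcard
  have hpos : ∀ᶠ n in atTop, 0 < Fintype.card (ι n) := hcard.eventually_gt_atTop 0
  have hinv : Tendsto (fun n => (√(Fintype.card (ι n) : ℝ))⁻¹) atTop (𝓝 0) :=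
    tendsto_inv_atTop_zero.comp (Real.tendsto_sqrt_atTop.comp hcard')
  set w1 : ℕ → ℝ := fun n => ((Finset.univ.sup fun p : ι n =>
      {t : ι n × ι n × ι n | r n (p, t.1) (t.2.1, t.2.2)}.ncard : ℕ) : ℝ) /
      (Fintype.card (ι n) : ℝ) ^ 2 with hw1
  set w3 : ℕ → ℝ := fun n => (pathCount (r n) : ℝ) / (Fintype.card (ι n) : ℝ) ^ 2 with hw3
  have t1 : Tendsto w1 atTop (𝓝 0) := hW1.tendsto_div_nhds_zero
  have t3 : Tendsto w3 atTop (𝓝 0) := by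
    simp only [hw3, pathCount_eq]
    exact hW3.tendsto_div_nhds_zero
  -- The bound for negligible walks divided by `√N ^ (k + 2)`, with `ε = w1 n + w3 n` serving (W1)
  -- and (W3) at once.
  have herr : Tendsto (fun n => (1 + k * K : ℝ) * (C * ((√(Fintype.card (ι n) : ℝ))⁻¹ +
      (w1 n + w3 n)))) atTop (𝓝 0) := by
    simpa using ((hinv.add (t1.add t3)).const_mul C).const_mul (1 + k * K : ℝ)
  rw [← add_zero (ballot k 1 : ℝ)]
  refine Tendsto.congr (fun n => add_sub_cancel _ _) (htree.add ?_)
  refine squeeze_zero_norm' ?_ herr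
  filter_upwards [hpos] with n hn
  have hN : (0 : ℝ) < Fintype.card (ι n) := by exact_mod_cast hn
  have hx : 0 < √(Fintype.card (ι n) : ℝ) := Real.sqrt_pos.2 hN
  have w1nn : 0 ≤ w1 n := by positivity
  have w3nn : 0 ≤ w3 n := by positivity
  have e1 : (equivCount (r n) : ℝ) ≤ (w1 n + w3 n) * (Fintype.card (ι n) : ℝ) ^ 3 := by
    calc _ ≤ _ := Nat.cast_le.2 (equivCount_le (r n))
      _ = w1 n * (Fintype.card (ι n) : ℝ) ^ 3 := by
        rw [hw1]
        push_cast
        field_simp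
      _ ≤ _ := by gcongr; linarith
  have e3 : (pathCount (r n) : ℝ) ≤ (w1 n + w3 n) * (Fintype.card (ι n) : ℝ) ^ 2 := by
    calc _ = w3 n * (Fintype.card (ι n) : ℝ) ^ 2 := by
          rw [hw3]
          field_simp
      _ ≤ _ := by gcongr; linarith
  have h1 := norm_integral_trace_sub_treeCount_le (hmeas n) (hindep n) (hstar n) (hvar n)
    (hcent n) (hzero n) (fun k => (hmom k).imp fun K hK => hK n) (hK n)
  have h2 := hneg (ι n) (r n) (S n) (w1 n + w3 n) hn (by positivity) (hswap n) (hB n) e1 e3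
  rw [← sub_div, norm_div, Real.norm_of_nonneg (by positivity : 0 ≤ √(Fintype.card (ι n) : ℝ) ^ _),
    div_le_iff₀ (by positivity)]
  calc _ = |(∫ ω, ((Matrix.of fun p q => a n p q ω) ^ k).trace ∂(P n) -
          treeCount (r n) (S n) k 1).re| := by simp
    _ ≤ _ := Complex.abs_re_le_norm _
    -- The two matrix powers differ only in the instance deciding equality of indices.
    _ ≤ _ := by convert h1
    _ ≤ (1 + k * K) * (C * (√(Fintype.card (ι n)) ^ (k + 1) +
          (w1 n + w3 n) * √(Fintype.card (ι n)) ^ (k + 2))) := by gcongr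
    _ = _ := by
      field_simp
      ring

end Moments

/-! ### Conclusion -/

theorem theorem3p1 (c : SymClass)
    {Ω : ℕ → Type*} [∀ n, MeasurableSpace (Ω n)]
    (P : ∀ n, Measure (Ω n)) [∀ n, IsProbabilityMeasure (P n)]
    -- the unscaled entries and the equivalence relations on pairs of indices
    (a : ∀ n, c.Index n → c.Index n → Ω n → ℂ)
    (r : ∀ n, Setoid (c.Index n × c.Index n))
    (hmeas : ∀ n p q, Measurable (a n p q))
    -- each entry is independent of the family of all entries that are not equivalent to it
    (hindep : ∀ n p q, IndepFun (a n p q)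
      (fun ω (t : {t : c.Index n × c.Index n // ¬ r n (p, q) t}) => a n t.1.1 t.1.2 ω) (P n))
    (hW1 : ConditionW1 c.Index r)
    (hW2 : ConditionW2 c.Index r)
    (hW3 : ConditionW3 c.Index r)
    -- uniformly bounded moments, centering, unit variance off the forced zeros
    (hmom : ∀ k : ℕ, ∃ K : ℝ≥0, ∀ n p q, ∫⁻ ω, ‖a n p q ω‖ₑ ^ k ∂(P n) ≤ K)
    (hcent : ∀ n p q, ∫ ω, a n p q ω ∂(P n) = 0)
    (hvar : ∀ n p q, (p, q) ∈ c.support n →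
      ∫ ω, a n p q ω * starRingEnd ℂ (a n p q ω) ∂(P n) = 1)
    -- all realizations of the random matrices belong to the class
    (hmem : ∀ n ω, scaledMatrix (a n) ω ∈ c.space n) :
    ConvergesWeakly
      (fun n => meanEmpiricalMeasure (P n) (scaledMatrix (a n))
        (fun ω => SymClass.isHermitian_of_mem (hmem n ω)))
      semicircleLaw := by
  -- The index argument excludes the empty matrix, for which the scaling factor would be `1 / 0 =
  -- 0`.
  have hscale : ∀ n (_ : c.Index n),
      ((1 / Real.sqrt (Fintype.card (c.Index n)) : ℝ) : ℂ) ≠ 0 := by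
    intro n p
    have : Nonempty (c.Index n) := ⟨p⟩
    have hN : (0 : ℝ) < Fintype.card (c.Index n) := by exact_mod_cast Fintype.card_pos
    exact Complex.ofReal_ne_zero.2 (one_div_pos.2 (Real.sqrt_pos.2 hN)).ne'
  have hstar : ∀ n p q ω, a n q p ω = starRingEnd ℂ (a n p q ω) := by
    intro n p q ω
    have h := (SymClass.isHermitian_of_mem (hmem n ω)).apply q p
    simp only [scaledMatrix, Matrix.of_apply, star_mul'] at h
    rw [Complex.star_def, Complex.conj_ofReal] at h
    exact (mul_left_cancel₀ (hscale n p) h).symm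
  have hzero : ∀ n p q, (p, q) ∉ c.support n → ∀ ω, a n p q ω = 0 := by
    intro n p q hpq ω
    by_contra h
    exact hpq ⟨_, hmem n ω, mul_ne_zero (hscale n p) h⟩
  have hpow : ∀ n k ω, (scaledMatrix (a n) ω ^ k).trace =
      ((1 / Real.sqrt (Fintype.card (c.Index n)) : ℝ) : ℂ) ^ k *
        ((Matrix.of fun p q => a n p q ω) ^ k).trace := by
    intro n k ω
    have : scaledMatrix (a n) ω = ((1 / Real.sqrt (Fintype.card (c.Index n)) : ℝ) : ℂ) •
        Matrix.of fun p q => a n p q ω := rfl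
    rw [this, smul_pow, Matrix.trace_smul, smul_eq_mul]
  have hint : ∀ n k, Integrable (fun ω => (scaledMatrix (a n) ω ^ k).trace) (P n) := by
    intro n k
    simp only [hpow, trace_pow_eq_sum_walks, Matrix.of_apply]
    refine Integrable.const_mul (integrable_finsetSum _ fun l _ => ?_) _
    split_ifs
    · exact integrable_prod_entries (hmeas n) (fun k => (hmom k).imp fun K hK => hK n) _
    · exact integrable_zero _ _ _
  have hX : ∀ n p q, Measurable fun ω => scaledMatrix (a n) ω p q := fun n p q =>
    (hmeas n p q).const_mul _
  have hne : ∀ᶠ n in atTop, Nonempty (c.Index n) :=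
    (c.tendsto_card_index.eventually_gt_atTop 0).mono fun n hn => Fintype.card_pos_iff.1 hn
  refine convergesWeakly_of_tendsto_moments semicircleLaw_compl_Icc ?_ fun k => ?_
  · filter_upwards [hne] with n hn
    exact ⟨isProbabilityMeasure_meanEmpiricalMeasure _ (hX n),
      integrable_pow_meanEmpiricalMeasure _ (hX n) (hint n)⟩
  · rw [integral_pow_semicircleLaw]
    refine (tendsto_congr' ?_).2 (tendsto_integral_trace_pow P a r c.support c.tendsto_card_index
      hmeas hindep hW1 hW2 hW3 hmom hcent hvar hstar hzero c.card_filter_notMem_support_le k)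
    filter_upwards [hne] with n hn
    have hN : (0 : ℝ) < Fintype.card (c.Index n) := by exact_mod_cast Fintype.card_pos
    rw [integral_pow_meanEmpiricalMeasure _ (hX n) (hint n)]
    simp only [hpow]
    rw [integral_const_mul, ← Complex.ofReal_pow, Complex.re_ofReal_mul, pow_add,
      Real.sq_sqrt hN.le, one_div, inv_pow]
    field_simp
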